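/- Consider the Burgers equation $L[u]:=u_t+uu_x+u_{xx}=0$ for real functions of $(t,x)$. Let $\Omega\subseteq\mathbb R^2$ be open and let $\xi^0,\eta^1,\eta^0$ be real functions of $(t,x)$. Put $$Q=\partial_t+\Bigl(-\tfrac12u+\xi^0\Bigr)\partial_x+\Bigl(\tfrac14u^3-\tfrac{\xi^0}{2}u^2+\eta^1u+\eta^0\Bigr)\partial_u .$$ A vector field $Q=\tau\partial_t+\xi\partial_x+\eta\partial_u$ whose coefficients are smooth functions of $(t,x,u)$ on $\Omega\times\mathbb R$, with $(\tau,\xi)\neq(0,0)$ everywhere, is called a reduction operator of the Burgers equation over $\Omega$ if it satisfies the conditional invariance criterion: $Q_{(2)}L$ vanishes at every point of the second-order jet space lying over $\Omega$ at which $L=0$, $Q[u]=0$, $D_tQ[u]=0$ and $D_xQ[u]=0$. Here $Q[u]=\eta-\tau u_t-\xi u_x$ is the characteristic, $Q_{(2)}$ is the second prolongation of $Q$, and $D_t,D_x$ are the total derivatives. For columns $\bar p,\bar q,\bar r\in\mathbb R^3$ let $|\bar p,\bar q,\bar r|$ be the determinant of the matrix with these columns. For smooth functions $u^1,u^2,u^3$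 of $(t,x)$ let $\bar e=(1,1,1)^T$, $\bar u=(u^i)_{i=1,2,3}$, $\bar y=(y^i)_{i=1,2,3}$ and $\bar z=(z^i)_{i=1,2,3}$, where $y^i=2u^i_x+(u^i)^2$ and $z^i=4u^i_{xx}+6u^iu^i_x+(u^i)^3$. We say that $(\xi^0,\eta^1,\eta^0)$ is represented on an open set $U\subseteq\Omega$ by $(u^1,u^2,u^3)$ if $u^1,u^2,u^3$ are smooth solutions of the Burgers equation on $U$, $|\bar e,\bar u,\bar y|\neq0$ at every point of $U$, and on $U$ $$\xi^0=\frac12\,\frac{|\bar e,\bar u,\bar z|}{|\bar e,\bar u,\bar y|},\qquad \eta^1=\frac14\,\frac{|\bar e,\bar y,\bar z|}{|\bar e,\bar u,\bar y|},\qquad \eta^0=-\frac14\,\frac{|\bar u,\bar y,\bar z|}{|\bar e,\bar u,\bar y|}.$$ Then: 1. If $Q$ is a reduction operator of the Burgers equation over $\Omega$, then every point of $\Omega$ has an open neighbourhood $U\subseteq\Omega$ on which $(\xi^0,\eta^1,\eta^0)$ is represented by some triple of solutions of the Burgers equation. 2. Conversely, if $(\xi^0,\eta^1,\eta^0)$ is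 represented on $\Omega$ by some triple of solutions of the Burgers equation, then $\xi^0,\eta^1,\eta^0$ are smooth on $\Omega$ and $Q$ is a reduction operator of the Burgers equation over $\Omega$. -/

import Mathlib

open scoped ContDiff

/-- A point `(t, x, u, u_t, u_x)` of the first-order jet space `J¹`. -/
structure Jet1 where
  t : ℝ
  x : ℝ
  u : ℝ
  ut : ℝ
  ux : ℝ

/-- A point `(t, x, u, u_t, u_x, u_tt, u_tx, u_xx)` of the second-order jet space `J²`. -/
structure Jet2 extends Jet1 where
  utt : ℝ
  utx : ℝ
  uxx : ℝ

/-- The total derivative `D_t F` of a differential function `F` of order at most one. -/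
noncomputable def totalDt (F : Jet1 → ℝ) (j : Jet2) : ℝ :=
  deriv (fun s => F { j.toJet1 with t := s }) j.t
    + j.ut * deriv (fun s => F { j.toJet1 with u := s }) j.u
    + j.utt * deriv (fun s => F { j.toJet1 with ut := s }) j.ut
    + j.utx * deriv (fun s => F { j.toJet1 with ux := s }) j.ux

/-- The total derivative `D_x F` of a differential function `F` of order at most one. -/
noncomputable def totalDx (F : Jet1 → ℝ) (j : Jet2) : ℝ :=
  deriv (fun s => F { j.toJet1 with x := s }) j.x
    + j.ux * deriv (fun s => F { j.toJet1 with u := s }) j.u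
    + j.utx * deriv (fun s => F { j.toJet1 with ut := s }) j.ut
    + j.uxx * deriv (fun s => F { j.toJet1 with ux := s }) j.ux

/-- A vector field `Q = τ(t,x,u)∂_t + ξ(t,x,u)∂_x + η(t,x,u)∂_u`. -/
structure PlaneVectorField where
  τ : ℝ → ℝ → ℝ → ℝ
  ξ : ℝ → ℝ → ℝ → ℝ
  η : ℝ → ℝ → ℝ → ℝ

namespace PlaneVectorField

/-- The total derivative `D_t f = f_t + u_t f_u` of a function `f(t,x,u)`, as a function on `J¹`. -/
noncomputable def baseDt (f : ℝ → ℝ → ℝ → ℝ) (j : Jet1) : ℝ :=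
  deriv (fun s => f s j.x j.u) j.t + j.ut * deriv (fun s => f j.t j.x s) j.u

/-- The total derivative `D_x f = f_x + u_x f_u` of a function `f(t,x,u)`, as a function on `J¹`. -/
noncomputable def baseDx (f : ℝ → ℝ → ℝ → ℝ) (j : Jet1) : ℝ :=
  deriv (fun s => f j.t s j.u) j.x + j.ux * deriv (fun s => f j.t j.x s) j.u

variable (Q : PlaneVectorField)

/-- The characteristic `Q[u] = η - τ u_t - ξ u_x`. -/
noncomputable def characteristic (j : Jet1) : ℝ :=
  Q.η j.t j.x j.u - Q.τ j.t j.x j.u * j.ut - Q.ξ j.t j.x j.u * j.ux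

/-- `η^t = D_t η - u_t D_t τ - u_x D_t ξ`. -/
noncomputable def prolT (j : Jet1) : ℝ :=
  baseDt Q.η j - j.ut * baseDt Q.τ j - j.ux * baseDt Q.ξ j

/-- `η^x = D_x η - u_t D_x τ - u_x D_x ξ`. -/
noncomputable def prolX (j : Jet1) : ℝ :=
  baseDx Q.η j - j.ut * baseDx Q.τ j - j.ux * baseDx Q.ξ j

/-- `η^tt = D_t η^t - u_tt D_t τ - u_tx D_t ξ`. -/
noncomputable def prolTT (j : Jet2) : ℝ :=
  totalDt Q.prolT j - j.utt * baseDt Q.τ j.toJet1 - j.utx * baseDt Q.ξ j.toJet1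

/-- `η^tx = D_x η^t - u_tt D_x τ - u_tx D_x ξ`. -/
noncomputable def prolTX (j : Jet2) : ℝ :=
  totalDx Q.prolT j - j.utt * baseDx Q.τ j.toJet1 - j.utx * baseDx Q.ξ j.toJet1

/-- `η^xx = D_x η^x - u_tx D_x τ - u_xx D_x ξ`. -/
noncomputable def prolXX (j : Jet2) : ℝ :=
  totalDx Q.prolX j - j.utx * baseDx Q.τ j.toJet1 - j.uxx * baseDx Q.ξ j.toJet1

/-- The action `Q_(2) F` of the second prolongation of `Q` on a function `F` on `J²`. -/
noncomputable def prol2 (F : Jet2 → ℝ) (j : Jet2) : ℝ :=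
  Q.τ j.t j.x j.u * deriv (fun s => F { j with t := s }) j.t
    + Q.ξ j.t j.x j.u * deriv (fun s => F { j with x := s }) j.x
    + Q.η j.t j.x j.u * deriv (fun s => F { j with u := s }) j.u
    + Q.prolT j.toJet1 * deriv (fun s => F { j with ut := s }) j.ut
    + Q.prolX j.toJet1 * deriv (fun s => F { j with ux := s }) j.ux
    + Q.prolTT j * deriv (fun s => F { j with utt := s }) j.utt
    + Q.prolTX j * deriv (fun s => F { j with utx := s }) j.utx
    + Q.prolXX j * deriv (fun s => F { j with uxx := s }) j.uxx

end PlaneVectorField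

/-- The left-hand side `L = u_t + u u_x + u_xx` of the Burgers equation, as a function on `J²`. -/
def burgersL (j : Jet2) : ℝ := j.ut + j.u * j.ux + j.uxx

/-- `Q` is a reduction operator of the Burgers equation over the domain `Ω` of the `(t,x)`-plane
(with `u` ranging over `ℝ`): its coefficients are smooth, `(τ, ξ)` does not vanish, and the
conditional invariance criterion holds, i.e. `Q_(2) L` vanishes at every jet over `Ω` with
`L = 0`, `Q[u] = 0`, `D_t Q[u] = 0` and `D_x Q[u] = 0`. -/
structure IsBurgersReductionOperator (Ω : Set (ℝ × ℝ)) (Q : PlaneVectorField) : Prop where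
  smooth_τ : ContDiffOn ℝ ∞ (fun p : (ℝ × ℝ) × ℝ => Q.τ p.1.1 p.1.2 p.2) (Ω ×ˢ Set.univ)
  smooth_ξ : ContDiffOn ℝ ∞ (fun p : (ℝ × ℝ) × ℝ => Q.ξ p.1.1 p.1.2 p.2) (Ω ×ˢ Set.univ)
  smooth_η : ContDiffOn ℝ ∞ (fun p : (ℝ × ℝ) × ℝ => Q.η p.1.1 p.1.2 p.2) (Ω ×ˢ Set.univ)
  nondegenerate : ∀ t x u : ℝ, (t, x) ∈ Ω → Q.τ t x u ≠ 0 ∨ Q.ξ t x u ≠ 0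
  criterion : ∀ j : Jet2, (j.t, j.x) ∈ Ω → burgersL j = 0 →
    Q.characteristic j.toJet1 = 0 → totalDt Q.characteristic j = 0 →
    totalDx Q.characteristic j = 0 → Q.prol2 burgersL j = 0

/-- The vector field
`∂_t + (-u/2 + ξ⁰) ∂_x + (u³/4 - (ξ⁰/2) u² + η¹ u + η⁰) ∂_u`, with `ξ⁰, η¹, η⁰` functions
of `(t, x)`. -/
noncomputable def noGoField (ξ0 η1 η0 : ℝ → ℝ → ℝ) : PlaneVectorField where
  τ := fun _ _ _ => 1
  ξ := fun t x u => -(1 / 2) * u + ξ0 t x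
  η := fun t x u => 1 / 4 * u ^ 3 - ξ0 t x / 2 * u ^ 2 + η1 t x * u + η0 t x

/-- The 2-jet at `(t, x)` of a function `u` of `(t, x)`. -/
noncomputable def jetOf (u : ℝ → ℝ → ℝ) (t x : ℝ) : Jet2 where
  t := t
  x := x
  u := u t x
  ut := deriv (fun s => u s x) t
  ux := deriv (fun y => u t y) x
  utt := deriv (fun s => deriv (fun r => u r x) s) t
  utx := deriv (fun s => deriv (fun y => u s y) x) t
  uxx := deriv (fun y => deriv (fun z => u t z) y) x

/-- `u` is a smooth solution of the Burgers equation `u_t + u u_x + u_xx = 0` on `U`. -/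
def IsBurgersSolution (U : Set (ℝ × ℝ)) (u : ℝ → ℝ → ℝ) : Prop :=
  ContDiffOn ℝ ∞ (fun p : ℝ × ℝ => u p.1 p.2) U ∧
    ∀ t x : ℝ, (t, x) ∈ U → burgersL (jetOf u t x) = 0

/-- The determinant `|p, q, r|` of the 3×3 matrix with columns `p`, `q`, `r`. -/
def colDet (p q r : Fin 3 → ℝ) : ℝ :=
  (Matrix.of fun i : Fin 3 => ![p i, q i, r i]).det

/-- The column of three units. -/
def eCol : Fin 3 → ℝ := fun _ => 1

/-- The column with entries `uⁱ(t, x)`. -/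
def uCol (u : Fin 3 → ℝ → ℝ → ℝ) (t x : ℝ) : Fin 3 → ℝ := fun i => u i t x

/-- The column with entries `yⁱ = 2 uⁱ_x + (uⁱ)²`. -/
noncomputable def yCol (u : Fin 3 → ℝ → ℝ → ℝ) (t x : ℝ) : Fin 3 → ℝ := fun i =>
  2 * (jetOf (u i) t x).ux + u i t x ^ 2

/-- The column with entries `zⁱ = 4 uⁱ_xx + 6 uⁱ uⁱ_x + (uⁱ)³`. -/
noncomputable def zCol (u : Fin 3 → ℝ → ℝ → ℝ) (t x : ℝ) : Fin 3 → ℝ := fun i =>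
  4 * (jetOf (u i) t x).uxx + 6 * u i t x * (jetOf (u i) t x).ux + u i t x ^ 3

/-- On `U`, the functions `ξ⁰, η¹, η⁰` are represented by the triple `u¹, u², u³` of solutions
of the Burgers equation, with `|e, u, y| ≠ 0`. -/
def IsBurgersTripleRepresentation (U : Set (ℝ × ℝ)) (u : Fin 3 → ℝ → ℝ → ℝ)
    (ξ0 η1 η0 : ℝ → ℝ → ℝ) : Prop :=
  (∀ i, IsBurgersSolution U (u i)) ∧
    ∀ t x : ℝ, (t, x) ∈ U →
      colDet eCol (uCol u t x) (yCol u t x) ≠ 0 ∧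
      ξ0 t x = 1 / 2 * (colDet eCol (uCol u t x) (zCol u t x)
        / colDet eCol (uCol u t x) (yCol u t x)) ∧
      η1 t x = 1 / 4 * (colDet eCol (yCol u t x) (zCol u t x)
        / colDet eCol (uCol u t x) (yCol u t x)) ∧
      η0 t x = -(1 / 4) * (colDet (uCol u t x) (yCol u t x) (zCol u t x)
        / colDet eCol (uCol u t x) (yCol u t x))

/-! Write `a`, `b`, `c` for the coefficients ξ⁰, η¹, η⁰. After u_xx and u_t are eliminated by L = 0
and Q[u] = 0, the criterion becomes a polynomial in u and u_x. Its coefficients are the left-hand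
sides Δ₁, Δ₂, Δ₃ of a system for `a`, `b`, `c`, the determining equations. As τ = 1, the conditions
D_tQ[u] = D_xQ[u] = 0 can be met by choosing u_tx and u_tt, which do not enter that polynomial. So Q
is a reduction operator exactly when Δ₁ = Δ₂ = Δ₃ = 0, given smooth coefficients.

For a solution u of the Burgers equation, Q[u] = 0 means z = 2ay - 4bu - 4c, where y and z are the
quantities in the determinants. For three solutions with |e,u,y| ≠ 0, Cramer's rule
(`cramer_colDet`) makes the representation formulas equivalent to this relation for each of them.
The task is to relate Q-invariant solutions to the determining equations.

From solutions to equations: the criterion evaluated on an invariant solution gives -Δ₁y/2 + Δ₂u +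
Δ₃ = 0 (`determining_relation_of_solution`). Three such relations with nonzero determinant force
every Δ to vanish.

From equations to solutions: the Hopf–Cole substitution u = 2v_x/v gives y = 4v_xx/v and z =
8v_xxx/v. It therefore suffices to solve the linear system v_t = -v_xx, v_xxx = av_xx - bv_x -
(c/2)v. Its compatibility condition is exactly the determining system, so the Frobenius theorem
(`exists_hasFDerivAt_of_flat`) gives local solutions with arbitrary (v, v_x, v_xx) at a point
(`exists_linear_solution`). Hence u and y can be prescribed there, and three suitable choices make
the determinant nonzero nearby. -/

open scoped Topology

/-! ### Frobenius theorem for linear total differential equations -/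

section Frobenius

theorem eventually_norm_lt_add_one {E F : Type*} [TopologicalSpace E] [NormedAddCommGroup F]
    {f : E → F} {p : E} (hf : ContinuousAt f p) :
    ∀ᶠ q in 𝓝 p, ‖f q‖ < ‖f p‖ + 1 :=
  hf.norm.eventually_lt_const (lt_add_one _)

variable {E F : Type*} [NormedAddCommGroup E] [NormedSpace ℝ E]
  [NormedAddCommGroup F] [NormedSpace ℝ F]

theorem hasDerivAt_comp_line {f : E → F} {p h : E} {s : ℝ}
    (hf : DifferentiableAt ℝ f (p + s • h)) :
    HasDerivAt (fun s : ℝ => f (p + s • h)) (fderiv ℝ f (p + s • h) h) s := by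
  have hline : HasDerivAt (fun s : ℝ => p + s • h) h s := by
    simpa using ((hasDerivAt_id s).smul_const h).const_add p
  exact hf.hasFDerivAt.comp_hasDerivAt s hline

/-- First order Taylor estimate for a function with Lipschitz derivative on a convex set. -/
theorem norm_sub_sub_fderiv_le {f : E → F} {K : NNReal} {S : Set E} (hS : Convex ℝ S)
    (hf : ∀ z ∈ S, DifferentiableAt ℝ f z) (hK : LipschitzOnWith K (fderiv ℝ f) S) {x y : E}
    (hx : x ∈ S) (hy : y ∈ S) :
    ‖f y - f x - fderiv ℝ f x (y - x)‖ ≤ K * ‖y - x‖ * ‖y - x‖ := by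
  have hseg : segment ℝ x y ⊆ S := hS.segment_subset hx hy
  refine (convex_segment x y).norm_image_sub_le_of_norm_fderiv_le'
    (fun z hz => hf z (hseg hz)) (fun z hz => ?_)
    (left_mem_segment ℝ _ _) (right_mem_segment ℝ _ _)
  refine (hK.norm_sub_le (hseg hz) hx).trans ?_
  gcongr
  exact norm_sub_le_of_mem_segment hz

/-- A linear ordinary differential equation whose coefficient has norm at most `1/2` on `[0, 1]` is
solvable on all of `[0, 1]`. -/
theorem exists_linear_ode_solution [CompleteSpace F] (A : ℝ → F →L[ℝ] F)
    (hA : ContinuousOn A (Set.Icc 0 1)) (hb : ∀ s ∈ Set.Icc (0 : ℝ) 1, ‖A s‖ ≤ 1 / 2) (v : F) :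
    ∃ W : ℝ → F, W 0 = v ∧
      ∀ s ∈ Set.Icc (0 : ℝ) 1, HasDerivWithinAt W (A s (W s)) (Set.Icc 0 1) s := by
  -- On the ball of radius ‖v‖ about v the field has norm at most (1/2)(2‖v‖) = ‖v‖, so the solution
  -- cannot leave the ball within unit time.
  have hPL : IsPicardLindelof (fun s w => A s w) (⟨0, by simp⟩ : Set.Icc (0 : ℝ) 1) v
      (‖v‖₊) 0 (‖v‖₊) 1 := by
    refine ⟨fun s hs => ?_, fun w _ => hA.clm_apply continuousOn_const, fun s hs w hw => ?_, ?_⟩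
    · refine ((A s).lipschitz.weaken ?_).lipschitzOnWith
      rw [← NNReal.coe_le_coe]
      exact (hb s hs).trans (by norm_num)
    · have h1 : ‖w‖ ≤ ‖v‖ + ‖v‖ := by
        have := norm_le_norm_add_norm_sub' w v
        rw [Metric.mem_closedBall, dist_eq_norm] at hw
        exact this.trans (by gcongr; exact hw)
      calc ‖A s w‖ ≤ 1 / 2 * (‖v‖ + ‖v‖) := (A s).le_of_opNorm_le_of_le (hb s hs) h1
        _ = _ := by simp; ring
    · simp
  obtain ⟨W, h0, hW⟩ := hPL.exists_eq_forall_mem_Icc_hasDerivWithinAt₀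
  exact ⟨W, h0, hW⟩

/-- **Frobenius theorem for linear systems.** If the connection form `Γ` is flat near `p`, then the
total differential equation `dV = Γ V` has a local solution with any prescribed value at `p`. -/
theorem exists_hasFDerivAt_of_flat [CompleteSpace F] (Γ : E → E →L[ℝ] F →L[ℝ] F) (p : E)
    (hΓ : ContDiffAt ℝ 2 Γ p)
    (flat : ∀ᶠ q in 𝓝 p, ∀ h k, fderiv ℝ Γ q h k + (Γ q k).comp (Γ q h)
      = fderiv ℝ Γ q k h + (Γ q h).comp (Γ q k)) (v : F) :
    ∃ V : E → F, V p = v ∧ ∀ᶠ q in 𝓝 p, HasFDerivAt V ((Γ q).flip (V q)) q := by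
  obtain ⟨K, S, hS, hK⟩ :=
    (hΓ.fderiv_right (m := 1) (by norm_num)).exists_lipschitzOnWith
  obtain ⟨K', S', hS', hK'⟩ := (hΓ.of_le (m := 1) (by norm_num)).exists_lipschitzOnWith
  have hd : ∀ᶠ q in 𝓝 p, DifferentiableAt ℝ Γ q :=
    (hΓ.eventually (by simp)).mono fun q hq => hq.differentiableAt (by norm_num)
  have hC : ∀ᶠ q in 𝓝 p, ‖Γ q‖ < ‖Γ p‖ + 1 :=
    eventually_norm_lt_add_one hΓ.continuousAt
  set C := ‖Γ p‖ + 1 with hCdef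
  have hC0 : 0 < C := by positivity
  obtain ⟨r, hr, hball⟩ := Metric.eventually_nhds_iff_ball.1
    ((Filter.eventually_mem_set.2 hS).and <| (Filter.eventually_mem_set.2 hS').and <|
      hd.and <| hC.and flat)
  -- With Cρ ≤ 1/2 the ODE along the ray s ↦ p + s h has coefficient of norm at most 1/2 whenever
  -- ‖h‖ < ρ, so it is solvable up to s = 1.
  obtain ⟨ρ, hρ, hρr, hρC⟩ : ∃ ρ > 0, ρ ≤ r ∧ C * ρ ≤ 1 / 2 :=
    ⟨min r (1 / (2 * C)), by positivity, min_le_left _ _,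
      (mul_le_mul_of_nonneg_left (min_le_right _ _) hC0.le).trans (by field_simp; rfl)⟩
  have hmem : ∀ h : E, ‖h‖ < ρ → ∀ s ∈ Set.Icc (0 : ℝ) 1, p + s • h ∈ Metric.ball p r := by
    intro h hh s hs
    rw [mem_ball_iff_norm, add_sub_cancel_left, norm_smul, Real.norm_of_nonneg hs.1]
    nlinarith [norm_nonneg h, hs.2]
  have hcont : ∀ h : E, ‖h‖ < ρ → ContinuousOn (fun s : ℝ => Γ (p + s • h) h) (Set.Icc 0 1) := by
    intro h hh s hs
    have h1 : ContinuousAt Γ (p + s • h) := (hball _ (hmem h hh s hs)).2.2.1.continuousAt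
    have h2 : ContinuousAt (fun s : ℝ => Γ (p + s • h)) s :=
      ContinuousAt.comp (f := fun s : ℝ => p + s • h) h1 (by fun_prop)
    exact (h2.clm_apply continuousAt_const).continuousWithinAt
  have hnorm : ∀ h : E, ‖h‖ < ρ → ∀ s ∈ Set.Icc (0 : ℝ) 1, ‖Γ (p + s • h) h‖ ≤ 1 / 2 := by
    intro h hh s hs
    exact ((Γ (p + s • h)).le_of_opNorm_le_of_le (hball _ (hmem h hh s hs)).2.2.2.1.le hh.le).trans
      hρC
  -- The candidate is V(p + h) = W_h(1), with W_h the solution along the ray in direction h. The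
  -- constant v for large h is a filler that lets W be chosen for every h.
  have hsol : ∀ h : E, ∃ W : ℝ → F, W 0 = v ∧ (‖h‖ < ρ → ∀ s ∈ Set.Icc (0 : ℝ) 1,
      HasDerivWithinAt W (Γ (p + s • h) h (W s)) (Set.Icc 0 1) s) := by
    intro h
    by_cases hh : ‖h‖ < ρ
    · obtain ⟨W, h0, hW⟩ := exists_linear_ode_solution _ (hcont h hh) (hnorm h hh) v
      exact ⟨W, h0, fun _ => hW⟩
    · exact ⟨fun _ => v, rfl, fun h' => absurd h' hh⟩
  choose W hW0 hW using hsol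
  refine ⟨fun q => W (q - p) 1, ?_, ?_⟩
  · have h0 := hW 0 (by simpa using hρ)
    have hc : ∀ s ∈ Set.Icc (0 : ℝ) 1, W 0 s = W 0 0 := by
      refine constant_of_has_deriv_right_zero (fun s hs => (h0 s hs).continuousWithinAt) ?_
      intro s hs
      have := (h0 s ⟨hs.1, hs.2.le⟩).mono_of_mem_nhdsWithin (Icc_mem_nhdsGE_of_mem hs)
      simpa using this
    simpa [hW0] using hc 1 (by simp)
  filter_upwards [Metric.ball_mem_nhds p hρ] with q hq
  obtain ⟨h, rfl⟩ : ∃ h, q = p + h := ⟨q - p, by abel⟩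
  have hh : ‖h‖ < ρ := by simpa using hq
  rw [hasFDerivAt_iff_isLittleO_nhds_zero]
  have hX := hW h hh
  set X := W h with hXdef
  have hXc : ContinuousOn X (Set.Icc 0 1) := fun s hs => (hX s hs).continuousWithinAt
  obtain ⟨B, hB⟩ := isCompact_Icc.exists_bound_of_continuousOn hXc
  have hB0 : 0 ≤ B := (norm_nonneg _).trans (hB 0 (by simp))
  -- The summands bound, in turn, the Taylor remainder of Γ, its increment applied to k, and the two
  -- second-order terms carrying Γ k x; see `hsplit`.
  set ε : ℝ := K * ‖h‖ * B + K' * B + (K' * ‖h‖ + C) * (C * B) with hε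
  have hε0 : 0 ≤ ε := by positivity
  refine Asymptotics.IsBigO.trans_isLittleO (g := fun k : E => ‖k‖ ^ 2) ?_
    (Asymptotics.isLittleO_norm_pow_id one_lt_two)
  refine Asymptotics.IsBigO.of_bound (gronwallBound 0 1 ε 1) ?_
  have hsmall : ∀ᶠ k : E in 𝓝 0, ‖h + k‖ < ρ := by
    have : ContinuousAt (fun k : E => ‖h + k‖) 0 := by fun_prop
    exact this.eventually_lt_const (by simpa using hh)
  filter_upwards [hsmall] with k hk
  have hY := hW (h + k) hk
  set Y := W (h + k) with hYdef
  -- If dV = Γ V, then W_{h+k}(s) - W_h(s) should be sΓ(k)W_h(s) to first order in k. `D` is the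
  -- error of this prediction; D(1) is the remainder in the definition of the derivative.
  set D : ℝ → F := fun s => Y s - X s - s • Γ (p + s • h) k (X s) with hDdef
  have hD : ∀ s ∈ Set.Icc (0 : ℝ) 1, HasDerivWithinAt D
      (Γ (p + s • (h + k)) (h + k) (Y s) - Γ (p + s • h) h (X s)
        - (s • (fderiv ℝ Γ (p + s • h) h k (X s)
            + Γ (p + s • h) k (Γ (p + s • h) h (X s)))
          + (1 : ℝ) • Γ (p + s • h) k (X s))) (Set.Icc 0 1) s := by
    intro s hs
    have hG : HasDerivAt (fun s : ℝ => Γ (p + s • h)) (fderiv ℝ Γ (p + s • h) h) s :=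
      hasDerivAt_comp_line (f := Γ) (p := p) (h := h) (s := s) (hball _ (hmem h hh s hs)).2.2.1
    have hGk : HasDerivAt (fun s : ℝ => Γ (p + s • h) k) (fderiv ℝ Γ (p + s • h) h k) s := by
      simpa using hG.clm_apply (hasDerivAt_const s k)
    exact ((hY s hs).sub (hX s hs)).sub
      ((hasDerivAt_id s).hasDerivWithinAt.smul (hGk.hasDerivWithinAt.clm_apply (hX s hs)))
  have hbound : ∀ s ∈ Set.Icc (0 : ℝ) 1,
      ‖Γ (p + s • (h + k)) (h + k) (Y s) - Γ (p + s • h) h (X s)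
        - (s • (fderiv ℝ Γ (p + s • h) h k (X s)
            + Γ (p + s • h) k (Γ (p + s • h) h (X s)))
          + (1 : ℝ) • Γ (p + s • h) k (X s))‖ ≤ 1 * ‖D s‖ + ε * ‖k‖ ^ 2 := by
    intro s hs
    have hm := hmem h hh s hs
    have hm' := hmem (h + k) hk s hs
    obtain ⟨hqS, hqS', hqd, hqC, hqf⟩ := hball _ hm
    obtain ⟨hqS₁, hqS₁', -, hqC₁, -⟩ := hball _ hm'
    have hGG := hK'.norm_sub_le hqS₁' hqS'
    have hTaylor := norm_sub_sub_fderiv_le (convex_ball p r) (fun z hz => (hball z hz).2.2.1)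
      (hK.mono fun z hz => (hball z hz).1) hm hm'
    have e : p + s • (h + k) - (p + s • h) = s • k := by module
    rw [e, norm_smul, Real.norm_of_nonneg hs.1] at hGG hTaylor
    -- Flatness replaces the derivative of Γ(k)X along h by that of Γ along k plus a reordered
    -- product. The terms linear in k then cancel against the Taylor expansion of Γ.
    have hflat := congrArg (fun T => T (X s)) (hqf h k)
    simp only [add_apply, ContinuousLinearMap.comp_apply] at hflat
    rw [hflat]
    have hYs : Y s = D s + X s + s • Γ (p + s • h) k (X s) := by simp only [hDdef]; abel
    have hn := hnorm (h + k) hk s hs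
    have hXB := hB s hs
    generalize Γ (p + s • (h + k)) = G' at *
    generalize Γ (p + s • h) = G at *
    generalize fderiv ℝ Γ (p + s • h) = DG at *
    generalize X s = x at *
    generalize D s = d at *
    have hsplit : G' (h + k) (Y s) - G h x
        - (s • (DG k h x + G h (G k x)) + (1 : ℝ) • G k x)
        = G' (h + k) d + ((G' - G - DG (s • k)) h x + (G' - G) k x
          + s • ((G' - G) h + G' k) (G k x)) := by
      rw [hYs]
      simp only [map_add, map_smul, add_apply, sub_apply,
        smul_apply]
      module
    have hs1 := hs.2
    have hs0 := hs.1
    rw [hsplit]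
    have hGk : ‖G k x‖ ≤ C * ‖k‖ * B :=
      (G k).le_of_opNorm_le_of_le (G.le_of_opNorm_le hqC.le k) hXB
    have hsk : s * ‖k‖ ≤ ‖k‖ := mul_le_of_le_one_left (norm_nonneg k) hs1
    have hGG' : ‖G' - G‖ ≤ K' * ‖k‖ := hGG.trans (by gcongr)
    have b1 : ‖G' (h + k) d‖ ≤ 1 * ‖d‖ :=
      (G' (h + k)).le_of_opNorm_le (hn.trans (by norm_num)) d
    have b2 : ‖(G' - G - DG (s • k)) h x‖ ≤ K * ‖k‖ * ‖k‖ * ‖h‖ * B :=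
      ContinuousLinearMap.le_of_opNorm_le_of_le _
        (ContinuousLinearMap.le_of_opNorm_le _ (hTaylor.trans (by gcongr)) h) hXB
    have b3 : ‖(G' - G) k x‖ ≤ K' * ‖k‖ * ‖k‖ * B :=
      ContinuousLinearMap.le_of_opNorm_le_of_le _
        (ContinuousLinearMap.le_of_opNorm_le _ hGG' k) hXB
    have b4 : ‖s • ((G' - G) h + G' k) (G k x)‖
        ≤ (K' * ‖k‖ * ‖h‖ + C * ‖k‖) * (C * ‖k‖ * B) := by
      rw [norm_smul, Real.norm_of_nonneg hs0]
      refine (mul_le_of_le_one_left (norm_nonneg _) hs1).trans ?_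
      exact ContinuousLinearMap.le_of_opNorm_le_of_le _
        (norm_add_le_of_le (ContinuousLinearMap.le_of_opNorm_le _ hGG' h)
          (G'.le_of_opNorm_le hqC₁.le k)) hGk
    calc _ ≤ 1 * ‖d‖ + (K * ‖k‖ * ‖k‖ * ‖h‖ * B + K' * ‖k‖ * ‖k‖ * B
          + (K' * ‖k‖ * ‖h‖ + C * ‖k‖) * (C * ‖k‖ * B)) :=
        norm_add_le_of_le b1 (norm_add_le_of_le (norm_add_le_of_le b2 b3) b4)
      _ = 1 * ‖d‖ + ε * ‖k‖ ^ 2 := by rw [hε]; ring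
  -- Since D(0) = 0 and ‖D'‖ ≤ ‖D‖ + ε‖k‖², Gronwall's inequality gives D(1) = O(‖k‖²).
  have hgron := norm_le_gronwallBound_of_norm_deriv_right_le (f := D) (δ := 0) (K := 1)
    (ε := ε * ‖k‖ ^ 2) (fun s hs => (hD s hs).continuousWithinAt)
    (fun s hs => (hD s ⟨hs.1, hs.2.le⟩).mono_of_mem_nhdsWithin (Icc_mem_nhdsGE_of_mem hs))
    (by simp [hDdef, hXdef, hYdef, hW0]) (fun s hs => hbound s ⟨hs.1, hs.2.le⟩) 1 (by simp)
  have hlin : gronwallBound 0 1 (ε * ‖k‖ ^ 2) (1 - 0) = gronwallBound 0 1 ε 1 * ‖k‖ ^ 2 := by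
    simp [gronwallBound_of_K_ne_0]; ring
  rw [hlin] at hgron
  have hD1 : W (p + h + k - p) 1 - W (p + h - p) 1
      - (Γ (p + h)).flip (W (p + h - p) 1) k = D 1 := by
    have e1 : p + h + k - p = h + k := by abel
    have e2 : p + h - p = h := by abel
    simp [hDdef, hXdef, hYdef, e1, e2]
  rw [hD1]
  simpa using hgron

end Frobenius

/-! ### Partial derivatives of smooth functions of (t, x) -/

section PartialDerivatives

/-- The partial derivative with respect to `t` of a function of `(t, x)`. -/
noncomputable def dt (f : ℝ → ℝ → ℝ) (t x : ℝ) : ℝ := deriv (fun s => f s x) t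

/-- The partial derivative with respect to `x` of a function of `(t, x)`. -/
noncomputable def dx (f : ℝ → ℝ → ℝ) (t x : ℝ) : ℝ := deriv (fun y => f t y) x

/-- Smoothness on a set of a function of `(t, x)`. -/
def SmoothOn (Ω : Set (ℝ × ℝ)) (f : ℝ → ℝ → ℝ) : Prop :=
  ContDiffOn ℝ ∞ (fun p : ℝ × ℝ => f p.1 p.2) Ω

variable {Ω : Set (ℝ × ℝ)} {f g : ℝ → ℝ → ℝ} {t x : ℝ}

theorem SmoothOn.contDiffAt (hf : SmoothOn Ω f) (hΩ : IsOpen Ω) (h : (t, x) ∈ Ω) :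
    ContDiffAt ℝ ∞ (fun p : ℝ × ℝ => f p.1 p.2) (t, x) :=
  ContDiffOn.contDiffAt hf (hΩ.mem_nhds h)

theorem hasDerivAt_slices_of_hasFDerivAt {f' : ℝ × ℝ →L[ℝ] ℝ}
    (hf : HasFDerivAt (fun p : ℝ × ℝ => f p.1 p.2) f' (t, x)) :
    HasDerivAt (fun s => f s x) (f' (1, 0)) t ∧ HasDerivAt (fun y => f t y) (f' (0, 1)) x :=
  ⟨HasFDerivAt.comp_hasDerivAt (l := fun p : ℝ × ℝ => f p.1 p.2) (f := fun s => (s, x)) t hf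
      ((hasDerivAt_id t).prodMk (hasDerivAt_const t x)),
    HasFDerivAt.comp_hasDerivAt (l := fun p : ℝ × ℝ => f p.1 p.2) (f := fun y => (t, y)) x hf
      ((hasDerivAt_const x t).prodMk (hasDerivAt_id x))⟩

theorem SmoothOn.hasFDerivAt (hf : SmoothOn Ω f) (hΩ : IsOpen Ω) (h : (t, x) ∈ Ω) :
    HasFDerivAt (fun p : ℝ × ℝ => f p.1 p.2)
      (fderiv ℝ (fun p : ℝ × ℝ => f p.1 p.2) (t, x)) (t, x) :=
  ((hf.contDiffAt hΩ h).differentiableAt (by simp)).hasFDerivAt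

theorem SmoothOn.dt_eq (hf : SmoothOn Ω f) (hΩ : IsOpen Ω) (h : (t, x) ∈ Ω) :
    dt f t x = fderiv ℝ (fun p : ℝ × ℝ => f p.1 p.2) (t, x) (1, 0) :=
  (hasDerivAt_slices_of_hasFDerivAt (hf.hasFDerivAt hΩ h)).1.deriv

theorem SmoothOn.dx_eq (hf : SmoothOn Ω f) (hΩ : IsOpen Ω) (h : (t, x) ∈ Ω) :
    dx f t x = fderiv ℝ (fun p : ℝ × ℝ => f p.1 p.2) (t, x) (0, 1) :=
  (hasDerivAt_slices_of_hasFDerivAt (hf.hasFDerivAt hΩ h)).2.deriv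

theorem SmoothOn.hasDerivAt_dt (hf : SmoothOn Ω f) (hΩ : IsOpen Ω) (h : (t, x) ∈ Ω) :
    HasDerivAt (fun s => f s x) (dt f t x) t :=
  (hasDerivAt_slices_of_hasFDerivAt (hf.hasFDerivAt hΩ h)).1.differentiableAt.hasDerivAt

theorem SmoothOn.hasDerivAt_dx (hf : SmoothOn Ω f) (hΩ : IsOpen Ω) (h : (t, x) ∈ Ω) :
    HasDerivAt (fun y => f t y) (dx f t x) x :=
  (hasDerivAt_slices_of_hasFDerivAt (hf.hasFDerivAt hΩ h)).2.differentiableAt.hasDerivAt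

theorem SmoothOn.dt (hf : SmoothOn Ω f) (hΩ : IsOpen Ω) : SmoothOn Ω (dt f) :=
  ((ContDiffOn.fderiv_of_isOpen hf hΩ (m := ∞) (by simp)).clm_apply
    (contDiffOn_const (c := ((1 : ℝ), (0 : ℝ))))).congr fun p hp => hf.dt_eq hΩ (x := p.2) hp

theorem SmoothOn.dx (hf : SmoothOn Ω f) (hΩ : IsOpen Ω) : SmoothOn Ω (dx f) :=
  ((ContDiffOn.fderiv_of_isOpen hf hΩ (m := ∞) (by simp)).clm_apply
    (contDiffOn_const (c := ((0 : ℝ), (1 : ℝ))))).congr fun p hp => hf.dx_eq hΩ (x := p.2) hp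

theorem eventually_slice_dt (hΩ : IsOpen Ω) (h : (t, x) ∈ Ω) : ∀ᶠ s in 𝓝 t, (s, x) ∈ Ω :=
  ContinuousAt.eventually_mem (f := fun s : ℝ => (s, x)) (by fun_prop) (hΩ.mem_nhds h)

theorem eventually_slice_dx (hΩ : IsOpen Ω) (h : (t, x) ∈ Ω) : ∀ᶠ y in 𝓝 x, (t, y) ∈ Ω :=
  ContinuousAt.eventually_mem (f := fun y : ℝ => (t, y)) (by fun_prop) (hΩ.mem_nhds h)

theorem dt_congr (hΩ : IsOpen Ω) (hfg : ∀ t x, (t, x) ∈ Ω → f t x = g t x) (h : (t, x) ∈ Ω) :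
    dt f t x = dt g t x :=
  Filter.EventuallyEq.deriv_eq ((eventually_slice_dt hΩ h).mono fun s hs => hfg s x hs)

theorem dx_congr (hΩ : IsOpen Ω) (hfg : ∀ t x, (t, x) ∈ Ω → f t x = g t x) (h : (t, x) ∈ Ω) :
    dx f t x = dx g t x :=
  Filter.EventuallyEq.deriv_eq ((eventually_slice_dx hΩ h).mono fun y hy => hfg t y hy)

/-- Both iterated slice derivatives are values of the second Fréchet derivative on the basis
vectors, in opposite orders, and that derivative is symmetric. -/
theorem SmoothOn.dt_dx (hf : SmoothOn Ω f) (hΩ : IsOpen Ω) (h : (t, x) ∈ Ω) :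
    _root_.dt (_root_.dx f) t x = _root_.dx (_root_.dt f) t x := by
  set F : ℝ × ℝ → ℝ := fun p => f p.1 p.2 with hF
  have hF2 : HasFDerivAt (fderiv ℝ F) (fderiv ℝ (fderiv ℝ F) (t, x)) (t, x) :=
    (((hf.contDiffAt hΩ h).fderiv_right (m := 1) (by norm_cast)).differentiableAt
      (by simp)).hasFDerivAt
  have hsymm : IsSymmSndFDerivAt ℝ F (t, x) :=
    (hf.contDiffAt hΩ h).isSymmSndFDerivAt
      (by simpa using! WithTop.coe_le_coe.2 (le_top (a := (2 : ℕ∞))))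
  have key : ∀ v : ℝ × ℝ, HasFDerivAt (fun p : ℝ × ℝ => fderiv ℝ F (p.1, p.2) v)
      ((fderiv ℝ (fderiv ℝ F) (t, x)).flip v) (t, x) := fun v => by
    simpa using! hF2.clm_apply (hasFDerivAt_const v (t, x))
  rw [dt_congr hΩ (g := fun t x => fderiv ℝ F (t, x) (0, 1)) (fun _ _ => hf.dx_eq hΩ) h,
    dx_congr hΩ (g := fun t x => fderiv ℝ F (t, x) (1, 0)) (fun _ _ => hf.dt_eq hΩ) h]
  have e1 := (hasDerivAt_slices_of_hasFDerivAt
    (f := fun t x => fderiv ℝ F (t, x) (0, 1)) (key (0, 1))).1.deriv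
  have e2 := (hasDerivAt_slices_of_hasFDerivAt
    (f := fun t x => fderiv ℝ F (t, x) (1, 0)) (key (1, 0))).2.deriv
  refine e1.trans (Eq.trans ?_ e2.symm)
  exact hsymm.eq _ _

end PartialDerivatives

/-! ### The invariance criterion as a polynomial on jets -/

section Criterion

/-- The system on `(ξ⁰, η¹, η⁰)` equivalent to the conditional invariance criterion. -/
def DeterminingEquations (Ω : Set (ℝ × ℝ)) (a b c : ℝ → ℝ → ℝ) : Prop :=
  ∀ t x, (t, x) ∈ Ω →
    dt a t x + dx (dx a) t x + 2 * a t x * dx a t x - 2 * dx b t x = 0 ∧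
    dt b t x + dx (dx b) t x + 2 * dx a t x * b t x + dx c t x = 0 ∧
    dt c t x + dx (dx c) t x + 2 * dx a t x * c t x = 0

/-- The functions differentiated here in u, u_t or u_x are polynomials of degree at most three in
that variable, so this one formula serves them all. -/
theorem hasDerivAt_cubic {f : ℝ → ℝ} (k₃ k₂ k₁ k₀ s : ℝ)
    (hf : ∀ s, f s = k₃ * s ^ 3 + k₂ * s ^ 2 + k₁ * s + k₀) :
    HasDerivAt f (3 * k₃ * s ^ 2 + 2 * k₂ * s + k₁) s := by
  rw [funext hf]
  refine (((((hasDerivAt_pow 3 s).const_mul k₃).add ((hasDerivAt_pow 2 s).const_mul k₂)).add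
    ((hasDerivAt_id s).const_mul k₁)).add_const k₀).congr_deriv ?_
  norm_num
  ring

theorem hasDerivAt_eta {A B C : ℝ → ℝ} {A' B' C' s : ℝ} (u : ℝ) (hA : HasDerivAt A A' s)
    (hB : HasDerivAt B B' s) (hC : HasDerivAt C C' s) :
    HasDerivAt (fun s => 1 / 4 * u ^ 3 - A s / 2 * u ^ 2 + B s * u + C s)
      (-(A' / 2 * u ^ 2) + B' * u + C') s :=
  (((((hA.div_const 2).mul_const (u ^ 2)).const_sub (1 / 4 * u ^ 3)).add
    (hB.mul_const u)).add hC)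

variable {Ω : Set (ℝ × ℝ)} {a b c : ℝ → ℝ → ℝ}

theorem noGoField_baseDx_tau (j : Jet1) : PlaneVectorField.baseDx (noGoField a b c).τ j = 0 := by
  simp [PlaneVectorField.baseDx, noGoField]

theorem noGoField_baseDt_tau (j : Jet1) : PlaneVectorField.baseDt (noGoField a b c).τ j = 0 := by
  simp [PlaneVectorField.baseDt, noGoField]

theorem noGoField_baseDx_xi (j : Jet1) :
    PlaneVectorField.baseDx (noGoField a b c).ξ j = dx a j.t j.x - 1 / 2 * j.ux := by
  have h1 : deriv (fun s => -(1 / 2) * j.u + a j.t s) j.x = dx a j.t j.x := by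
    simp [deriv_const_add, dx]
  have h2 := (hasDerivAt_cubic (f := fun s => -(1 / 2) * s + a j.t j.x) 0 0 (-(1 / 2)) (a j.t j.x)
    j.u (fun s => by ring)).deriv
  simp only [PlaneVectorField.baseDx, noGoField]
  rw [h1, h2]
  ring

theorem noGoField_baseDt_xi (j : Jet1) :
    PlaneVectorField.baseDt (noGoField a b c).ξ j = dt a j.t j.x - 1 / 2 * j.ut := by
  have h1 : deriv (fun s => -(1 / 2) * j.u + a s j.x) j.t = dt a j.t j.x := by
    simp [deriv_const_add, dt]
  have h2 := (hasDerivAt_cubic (f := fun s => -(1 / 2) * s + a j.t j.x) 0 0 (-(1 / 2)) (a j.t j.x)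
    j.u (fun s => by ring)).deriv
  simp only [PlaneVectorField.baseDt, noGoField]
  rw [h1, h2]
  ring

theorem noGoField_deriv_eta_u (t x u : ℝ) :
    deriv (fun s => (noGoField a b c).η t x s) u = 3 / 4 * u ^ 2 - a t x * u + b t x := by
  refine (hasDerivAt_cubic (1 / 4) (-(a t x / 2)) (b t x) (c t x) u
    (fun s => ?_)).deriv.trans (by ring)
  simp only [noGoField]
  ring

theorem noGoField_baseDx_eta (hΩ : IsOpen Ω) (ha : SmoothOn Ω a) (hb : SmoothOn Ω b)
    (hc : SmoothOn Ω c) (j : Jet1) (hj : (j.t, j.x) ∈ Ω) :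
    PlaneVectorField.baseDx (noGoField a b c).η j =
      -(dx a j.t j.x / 2 * j.u ^ 2) + dx b j.t j.x * j.u + dx c j.t j.x
        + j.ux * (3 / 4 * j.u ^ 2 - a j.t j.x * j.u + b j.t j.x) := by
  rw [PlaneVectorField.baseDx, noGoField_deriv_eta_u]
  congr 1
  exact (hasDerivAt_eta j.u (ha.hasDerivAt_dx hΩ hj) (hb.hasDerivAt_dx hΩ hj)
    (hc.hasDerivAt_dx hΩ hj)).deriv

theorem noGoField_baseDt_eta (hΩ : IsOpen Ω) (ha : SmoothOn Ω a) (hb : SmoothOn Ω b)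
    (hc : SmoothOn Ω c) (j : Jet1) (hj : (j.t, j.x) ∈ Ω) :
    PlaneVectorField.baseDt (noGoField a b c).η j =
      -(dt a j.t j.x / 2 * j.u ^ 2) + dt b j.t j.x * j.u + dt c j.t j.x
        + j.ut * (3 / 4 * j.u ^ 2 - a j.t j.x * j.u + b j.t j.x) := by
  rw [PlaneVectorField.baseDt, noGoField_deriv_eta_u]
  congr 1
  exact (hasDerivAt_eta j.u (ha.hasDerivAt_dt hΩ hj) (hb.hasDerivAt_dt hΩ hj)
    (hc.hasDerivAt_dt hΩ hj)).deriv

theorem noGoField_prolT (hΩ : IsOpen Ω) (ha : SmoothOn Ω a) (hb : SmoothOn Ω b)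
    (hc : SmoothOn Ω c) (j : Jet1) (hj : (j.t, j.x) ∈ Ω) :
    (noGoField a b c).prolT j =
      -(dt a j.t j.x / 2 * j.u ^ 2) + dt b j.t j.x * j.u + dt c j.t j.x
        + j.ut * (3 / 4 * j.u ^ 2 - a j.t j.x * j.u + b j.t j.x)
        - j.ux * (dt a j.t j.x - 1 / 2 * j.ut) := by
  rw [PlaneVectorField.prolT, noGoField_baseDt_tau, noGoField_baseDt_xi,
    noGoField_baseDt_eta hΩ ha hb hc j hj]
  ring

theorem noGoField_prolX (hΩ : IsOpen Ω) (ha : SmoothOn Ω a) (hb : SmoothOn Ω b)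
    (hc : SmoothOn Ω c) (j : Jet1) (hj : (j.t, j.x) ∈ Ω) :
    (noGoField a b c).prolX j =
      -(dx a j.t j.x / 2 * j.u ^ 2) + dx b j.t j.x * j.u + dx c j.t j.x
        + j.ux * (3 / 4 * j.u ^ 2 - a j.t j.x * j.u + b j.t j.x)
        - j.ux * (dx a j.t j.x - 1 / 2 * j.ux) := by
  rw [PlaneVectorField.prolX, noGoField_baseDx_tau, noGoField_baseDx_xi,
    noGoField_baseDx_eta hΩ ha hb hc j hj]
  ring

theorem noGoField_prolXX (hΩ : IsOpen Ω) (ha : SmoothOn Ω a) (hb : SmoothOn Ω b)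
    (hc : SmoothOn Ω c) (j : Jet2) (hj : (j.t, j.x) ∈ Ω) :
    (noGoField a b c).prolXX j =
      -(dx (dx a) j.t j.x / 2 * j.u ^ 2) + dx (dx b) j.t j.x * j.u + dx (dx c) j.t j.x
        + j.ux * (-(dx a j.t j.x * j.u) + dx b j.t j.x) - j.ux * dx (dx a) j.t j.x
        + j.ux * (-(dx a j.t j.x * j.u) + dx b j.t j.x
          + j.ux * (3 / 2 * j.u - a j.t j.x))
        + j.uxx * (3 / 4 * j.u ^ 2 - a j.t j.x * j.u + b j.t j.x - dx a j.t j.x + j.ux)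
        - j.uxx * (dx a j.t j.x - 1 / 2 * j.ux) := by
  obtain ⟨⟨t, x, u, ut, ux⟩, utt, utx, uxx⟩ := j
  simp only at hj
  rw [PlaneVectorField.prolXX, noGoField_baseDx_tau, noGoField_baseDx_xi, totalDx]
  simp only
  have h1 : deriv (fun s => (noGoField a b c).prolX ⟨t, s, u, ut, ux⟩) x =
      -(dx (dx a) t x / 2 * u ^ 2) + dx (dx b) t x * u + dx (dx c) t x
        + ux * (-(dx a t x * u) + dx b t x) - ux * dx (dx a) t x := by
    -- The closed form of `prolX` is known only over Ω, so the x-derivative needs equality near x;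
    -- the other jet variables leave the base point fixed.
    have hev : (fun s => (noGoField a b c).prolX ⟨t, s, u, ut, ux⟩) =ᶠ[𝓝 x] fun s =>
        -(dx a t s / 2 * u ^ 2) + dx b t s * u + dx c t s
        + ux * (3 / 4 * u ^ 2 - a t s * u + b t s) - ux * (dx a t s - 1 / 2 * ux) :=
      (eventually_slice_dx hΩ hj).mono fun s hs =>
        noGoField_prolX hΩ ha hb hc ⟨t, s, u, ut, ux⟩ hs
    rw [hev.deriv_eq]
    have ha1 := ha.hasDerivAt_dx hΩ hj
    have hb1 := hb.hasDerivAt_dx hΩ hj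
    have ha2 := (ha.dx hΩ).hasDerivAt_dx hΩ hj
    have hb2 := (hb.dx hΩ).hasDerivAt_dx hΩ hj
    have hc2 := (hc.dx hΩ).hasDerivAt_dx hΩ hj
    exact (((((((ha2.div_const 2).mul_const (u ^ 2)).neg).add (hb2.mul_const u)).add hc2).add
      ((((ha1.mul_const u).const_sub (3 / 4 * u ^ 2)).add hb1).const_mul ux)).sub
      ((ha2.sub_const (1 / 2 * ux)).const_mul ux)).deriv
  have h2 : deriv (fun s => (noGoField a b c).prolX ⟨t, x, s, ut, ux⟩) u =
      -(dx a t x * u) + dx b t x + ux * (3 / 2 * u - a t x) := by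
    refine (hasDerivAt_cubic 0 (-(dx a t x / 2) + 3 / 4 * ux) (dx b t x - a t x * ux)
      (dx c t x + ux * b t x - ux * (dx a t x - 1 / 2 * ux)) u
      (fun s => ?_)).deriv.trans (by ring)
    rw [noGoField_prolX hΩ ha hb hc _ hj]
    ring
  have h3 : deriv (fun s => (noGoField a b c).prolX ⟨t, x, u, s, ux⟩) ut = 0 := by
    have : ∀ s, (noGoField a b c).prolX ⟨t, x, u, s, ux⟩
        = (noGoField a b c).prolX ⟨t, x, u, ut, ux⟩ := fun s => by
      rw [noGoField_prolX hΩ ha hb hc _ hj, noGoField_prolX hΩ ha hb hc _ hj]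
    rw [funext this, deriv_const]
  have h4 : deriv (fun s => (noGoField a b c).prolX ⟨t, x, u, ut, s⟩) ux =
      3 / 4 * u ^ 2 - a t x * u + b t x - dx a t x + ux := by
    refine (hasDerivAt_cubic 0 (1 / 2) (3 / 4 * u ^ 2 - a t x * u + b t x - dx a t x)
      (-(dx a t x / 2 * u ^ 2) + dx b t x * u + dx c t x) ux
      (fun s => ?_)).deriv.trans (by ring)
    rw [noGoField_prolX hΩ ha hb hc _ hj]
    ring
  rw [h1, h2, h3, h4]
  ring

/-- L does not involve t, x, u_tt or u_tx, so the coefficients η^tt and η^tx drop out and are never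
computed. -/
theorem prol2_burgersL (Q : PlaneVectorField) (j : Jet2) :
    Q.prol2 burgersL j = Q.prolT j.toJet1 + Q.η j.t j.x j.u * j.ux + j.u * Q.prolX j.toJet1
      + Q.prolXX j := by
  obtain ⟨⟨t, x, u, ut, ux⟩, utt, utx, uxx⟩ := j
  have h1 : deriv (fun s => ut + s * ux + uxx) u = ux :=
    (hasDerivAt_cubic 0 0 ux (ut + uxx) u (fun s => by ring)).deriv.trans (by ring)
  have h2 : deriv (fun s => s + u * ux + uxx) ut = 1 :=
    (hasDerivAt_cubic 0 0 1 (u * ux + uxx) ut (fun s => by ring)).deriv.trans (by ring)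
  have h3 : deriv (fun s => ut + u * s + uxx) ux = u :=
    (hasDerivAt_cubic 0 0 u (ut + uxx) ux (fun s => by ring)).deriv.trans (by ring)
  have h4 : deriv (fun s => ut + u * ux + s) uxx = 1 :=
    (hasDerivAt_cubic 0 0 1 (ut + u * ux) uxx (fun s => by ring)).deriv.trans (by ring)
  simp only [PlaneVectorField.prol2, burgersL, h1, h2, h3, h4, deriv_const]
  ring

/-- On the manifold `L = 0`, `Q[u] = 0` the criterion reduces to a polynomial in `u` and `u_x` whose
coefficients are the left-hand sides of the determining equations. -/
theorem noGoField_prol2_burgersL (hΩ : IsOpen Ω) (ha : SmoothOn Ω a) (hb : SmoothOn Ω b)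
    (hc : SmoothOn Ω c) (j : Jet2) (hj : (j.t, j.x) ∈ Ω) (hL : burgersL j = 0)
    (hQ : (noGoField a b c).characteristic j.toJet1 = 0) :
    (noGoField a b c).prol2 burgersL j =
      -((dt a j.t j.x + dx (dx a) j.t j.x + 2 * a j.t j.x * dx a j.t j.x - 2 * dx b j.t j.x)
          * (j.ux + j.u ^ 2 / 2))
      + (dt b j.t j.x + dx (dx b) j.t j.x + 2 * dx a j.t j.x * b j.t j.x + dx c j.t j.x) * j.u
      + (dt c j.t j.x + dx (dx c) j.t j.x + 2 * dx a j.t j.x * c j.t j.x) := by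
  rw [prol2_burgersL, noGoField_prolT hΩ ha hb hc _ hj, noGoField_prolX hΩ ha hb hc _ hj,
    noGoField_prolXX hΩ ha hb hc _ hj]
  simp only [burgersL] at hL
  simp only [PlaneVectorField.characteristic, noGoField] at hQ ⊢
  have h1 : j.uxx = -j.ut - j.u * j.ux := by linear_combination hL
  have h2 : j.ut = 1 / 4 * j.u ^ 3 - a j.t j.x / 2 * j.u ^ 2 + b j.t j.x * j.u + c j.t j.x
    - (-(1 / 2) * j.u + a j.t j.x) * j.ux := by linear_combination -hQ
  rw [h1, h2]
  ring

end Criterion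

/-! ### Reduction operators and the determining equations -/

section ReductionOperator

variable {Ω : Set (ℝ × ℝ)} {a b c : ℝ → ℝ → ℝ}

/-- The three functions are recovered from values of ξ at u = 0 and of η at u = 0 and u = 1. -/
theorem smoothOn_of_isBurgersReductionOperator
    (h : IsBurgersReductionOperator Ω (noGoField a b c)) :
    SmoothOn Ω a ∧ SmoothOn Ω b ∧ SmoothOn Ω c := by
  have hmaps : ∀ u : ℝ, Set.MapsTo (fun q : ℝ × ℝ => (q, u)) Ω (Ω ×ˢ Set.univ) :=
    fun u q hq => ⟨hq, trivial⟩
  have hslice : ∀ u : ℝ, ContDiffOn ℝ ∞ (fun q : ℝ × ℝ => (q, u)) Ω :=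
    fun u => contDiffOn_id.prodMk contDiffOn_const
  have ha : SmoothOn Ω a := (h.smooth_ξ.comp (hslice 0) (hmaps 0)).congr fun q _ => by
    simp [noGoField]
  have hc : SmoothOn Ω c := (h.smooth_η.comp (hslice 0) (hmaps 0)).congr fun q _ => by
    simp [noGoField]
  have hb : SmoothOn Ω b := by
    have h1 := h.smooth_η.comp (hslice 1) (hmaps 1)
    refine (((h1.sub hc).add (ContDiffOn.div_const ha 2)).sub
      (contDiffOn_const (c := (1 / 4 : ℝ)))).congr fun q _ => ?_
    simp [noGoField]
    ring
  exact ⟨ha, hb, hc⟩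

/-- Over each base point u and u_x are free: the remaining jet coordinates can be solved from the
constraints. The criterion polynomial thus vanishes identically, and so do its coefficients. -/
theorem determiningEquations_of_isBurgersReductionOperator (hΩ : IsOpen Ω)
    (h : IsBurgersReductionOperator Ω (noGoField a b c)) : DeterminingEquations Ω a b c := by
  obtain ⟨ha, hb, hc⟩ := smoothOn_of_isBurgersReductionOperator h
  intro t x hp
  have key : ∀ u ux : ℝ,
      -((dt a t x + dx (dx a) t x + 2 * a t x * dx a t x - 2 * dx b t x) * (ux + u ^ 2 / 2))
      + (dt b t x + dx (dx b) t x + 2 * dx a t x * b t x + dx c t x) * u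
      + (dt c t x + dx (dx c) t x + 2 * dx a t x * c t x) = 0 := by
    intro u ux
    set ut : ℝ := (noGoField a b c).η t x u - (noGoField a b c).ξ t x u * ux with hut
    set uxx : ℝ := -ut - u * ux with huxx
    set χ := (noGoField a b c).characteristic with hχ
    have hχt : deriv (fun s => χ ⟨t, x, u, s, ux⟩) ut = -1 := by
      refine (hasDerivAt_cubic 0 0 (-1) ((noGoField a b c).η t x u
        - (noGoField a b c).ξ t x u * ux) ut (fun s => ?_)).deriv.trans (by ring)
      simp only [hχ, PlaneVectorField.characteristic, noGoField]
      ring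
    -- The characteristic has u_t-coefficient -τ = -1, so D_xQ[u] = 0 is solved for u_tx, and then
    -- D_tQ[u] = 0 for u_tt.
    obtain ⟨utx, hx⟩ : ∃ utx, ∀ utt, totalDx χ ⟨⟨t, x, u, ut, ux⟩, utt, utx, uxx⟩ = 0 := by
      refine ⟨deriv (fun s => χ ⟨t, s, u, ut, ux⟩) x + ux * deriv (fun s => χ ⟨t, x, s, ut, ux⟩) u
        + uxx * deriv (fun s => χ ⟨t, x, u, ut, s⟩) ux, fun utt => ?_⟩
      simp only [totalDx]
      rw [hχt]
      ring
    obtain ⟨utt, ht⟩ : ∃ utt, totalDt χ ⟨⟨t, x, u, ut, ux⟩, utt, utx, uxx⟩ = 0 := by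
      refine ⟨deriv (fun s => χ ⟨s, x, u, ut, ux⟩) t + ut * deriv (fun s => χ ⟨t, x, s, ut, ux⟩) u
        + utx * deriv (fun s => χ ⟨t, x, u, ut, s⟩) ux, ?_⟩
      simp only [totalDt]
      rw [hχt]
      ring
    have hL : burgersL ⟨⟨t, x, u, ut, ux⟩, utt, utx, uxx⟩ = 0 := by
      simp only [burgersL, huxx]
      ring
    have hQ : (noGoField a b c).characteristic ⟨t, x, u, ut, ux⟩ = 0 := by
      simp only [PlaneVectorField.characteristic, hut, noGoField]
      ring
    exact (noGoField_prol2_burgersL hΩ ha hb hc ⟨⟨t, x, u, ut, ux⟩, utt, utx, uxx⟩ hp hL hQ).symm.trans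
      (h.criterion _ hp hL hQ ht (hx utt))
  have k0 := key 0 0
  have k1 := key 0 1
  have k2 := key 1 0
  refine ⟨?_, ?_, ?_⟩
  · linear_combination k0 - k1
  · linear_combination k2 - k0 - 1 / 2 * (k1 - k0)
  · linear_combination k0

theorem isBurgersReductionOperator_of_determiningEquations (hΩ : IsOpen Ω) (ha : SmoothOn Ω a)
    (hb : SmoothOn Ω b) (hc : SmoothOn Ω c) (h : DeterminingEquations Ω a b c) :
    IsBurgersReductionOperator Ω (noGoField a b c) := by
  have hfst : Set.MapsTo (Prod.fst : (ℝ × ℝ) × ℝ → ℝ × ℝ) (Ω ×ˢ Set.univ) Ω := fun p hp => hp.1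
  have ha' : ContDiffOn ℝ ∞ (fun p : (ℝ × ℝ) × ℝ => a p.1.1 p.1.2) (Ω ×ˢ Set.univ) :=
    ContDiffOn.comp (g := fun q : ℝ × ℝ => a q.1 q.2) ha contDiffOn_fst hfst
  have hb' : ContDiffOn ℝ ∞ (fun p : (ℝ × ℝ) × ℝ => b p.1.1 p.1.2) (Ω ×ˢ Set.univ) :=
    ContDiffOn.comp (g := fun q : ℝ × ℝ => b q.1 q.2) hb contDiffOn_fst hfst
  have hc' : ContDiffOn ℝ ∞ (fun p : (ℝ × ℝ) × ℝ => c p.1.1 p.1.2) (Ω ×ˢ Set.univ) :=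
    ContDiffOn.comp (g := fun q : ℝ × ℝ => c q.1 q.2) hc contDiffOn_fst hfst
  have hu : ContDiffOn ℝ ∞ (fun p : (ℝ × ℝ) × ℝ => p.2) (Ω ×ˢ Set.univ) := contDiffOn_snd
  refine ⟨contDiffOn_const, (contDiffOn_const.mul hu).add ha',
    (((contDiffOn_const.mul (hu.pow 3)).sub ((ha'.div_const 2).mul (hu.pow 2))).add
      (hb'.mul hu)).add hc', fun t x u _ => Or.inl one_ne_zero, fun j hj hL hQ _ _ => ?_⟩
  obtain ⟨h1, h2, h3⟩ := h _ _ hj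
  rw [noGoField_prol2_burgersL hΩ ha hb hc j hj hL hQ, h1, h2, h3]
  ring

end ReductionOperator

/-! ### Cramer's rule for the determinants |p, q, r| -/

section Cramer

theorem colDet_eCol (q r : Fin 3 → ℝ) :
    colDet eCol q r = q 1 * r 2 - q 2 * r 1 + (q 2 * r 0 - q 0 * r 2)
      + (q 0 * r 1 - q 1 * r 0) := by
  simp [colDet, eCol, Matrix.det_fin_three]
  ring

theorem colDet_apply (p q r : Fin 3 → ℝ) :
    colDet p q r = p 0 * (q 1 * r 2 - q 2 * r 1) + p 1 * (q 2 * r 0 - q 0 * r 2)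
      + p 2 * (q 0 * r 1 - q 1 * r 0) := by
  simp [colDet, Matrix.det_fin_three]
  ring

theorem eq_zero_of_colDet_ne_zero {u y : Fin 3 → ℝ} (hD : colDet eCol u y ≠ 0) {α β γ : ℝ}
    (h : ∀ i, α * y i + β * u i + γ = 0) : α = 0 ∧ β = 0 ∧ γ = 0 := by
  have h0 := h 0
  have h1 := h 1
  have h2 := h 2
  rw [colDet_eCol] at hD
  refine ⟨?_, ?_, ?_⟩ <;> refine (mul_eq_zero.1 ?_).resolve_right hD
  -- In each of the three cases the multipliers are the cofactors of the column belonging to the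
  -- unknown being isolated.
  · linear_combination (u 2 - u 1) * h0 + (u 0 - u 2) * h1 + (u 1 - u 0) * h2
  · linear_combination (y 1 - y 2) * h0 + (y 2 - y 0) * h1 + (y 0 - y 1) * h2
  · linear_combination (u 1 * y 2 - u 2 * y 1) * h0 + (u 2 * y 0 - u 0 * y 2) * h1
      + (u 0 * y 1 - u 1 * y 0) * h2

/-- Cramer's rule for the system `zⁱ = 2 a yⁱ - 4 b uⁱ - 4 c`. -/
theorem cramer_colDet {u y z : Fin 3 → ℝ} (hD : colDet eCol u y ≠ 0) {a b c : ℝ} :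
    (a = 1 / 2 * (colDet eCol u z / colDet eCol u y) ∧
      b = 1 / 4 * (colDet eCol y z / colDet eCol u y) ∧
      c = -(1 / 4) * (colDet u y z / colDet eCol u y)) ↔
    ∀ i, z i = 2 * a * y i - 4 * b * u i - 4 * c := by
  constructor
  · rintro ⟨rfl, rfl, rfl⟩ i
    field_simp
    simp only [colDet_eCol, colDet_apply u y z]
    fin_cases i <;> simp <;> ring
  · intro h
    have h0 := h 0
    have h1 := h 1
    have h2 := h 2
    refine ⟨?_, ?_, ?_⟩
    · field_simp
      simp only [colDet_eCol, h0, h1, h2]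
      ring
    · field_simp
      simp only [colDet_eCol, h0, h1, h2]
      ring
    · field_simp
      simp only [colDet_eCol, colDet_apply u y z, h0, h1, h2]
      ring

end Cramer

/-! ### From three invariant solutions to a reduction operator -/

section InvariantSolutions

variable {Ω : Set (ℝ × ℝ)} {a b c u : ℝ → ℝ → ℝ}

/-- A solution of the Burgers equation that satisfies `Q[u] = 0` gives a linear relation between
the left-hand sides of the determining equations. -/
theorem determining_relation_of_solution (hΩ : IsOpen Ω) (ha : SmoothOn Ω a) (hb : SmoothOn Ω b)
    (hc : SmoothOn Ω c) (hu : IsBurgersSolution Ω u)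
    (hz : ∀ t x, (t, x) ∈ Ω → 4 * dx (dx u) t x + 6 * u t x * dx u t x + u t x ^ 3
      = 2 * a t x * (2 * dx u t x + u t x ^ 2) - 4 * b t x * u t x - 4 * c t x)
    {t x : ℝ} (hp : (t, x) ∈ Ω) :
    -((dt a t x + dx (dx a) t x + 2 * a t x * dx a t x - 2 * dx b t x)
          * (dx u t x + u t x ^ 2 / 2))
      + (dt b t x + dx (dx b) t x + 2 * dx a t x * b t x + dx c t x) * u t x
      + (dt c t x + dx (dx c) t x + 2 * dx a t x * c t x) = 0 := by
  have hs : SmoothOn Ω u := hu.1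
  have hsx := hs.dx hΩ
  have hst := hs.dt hΩ
  have hsxx := hsx.dx hΩ
  have hL : ∀ t x, (t, x) ∈ Ω → dt u t x + u t x * dx u t x + dx (dx u) t x = 0 := hu.2
  -- Eliminating u_xx between the Burgers equation and the relation for z yields Q[u] = 0, solved
  -- for u_t.
  have hχ : ∀ t x, (t, x) ∈ Ω → dt u t x = 1 / 4 * u t x ^ 3 - a t x / 2 * u t x ^ 2
      + b t x * u t x + c t x - (a t x - 1 / 2 * u t x) * dx u t x := by
    intro t x h
    linear_combination hL t x h - 1 / 4 * hz t x h
  have a1 := ha.hasDerivAt_dx hΩ hp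
  have b1 := hb.hasDerivAt_dx hΩ hp
  have c1 := hc.hasDerivAt_dx hΩ hp
  have at1 := ha.hasDerivAt_dt hΩ hp
  have bt1 := hb.hasDerivAt_dt hΩ hp
  have ct1 := hc.hasDerivAt_dt hΩ hp
  have a2 := (ha.dx hΩ).hasDerivAt_dx hΩ hp
  have b2 := (hb.dx hΩ).hasDerivAt_dx hΩ hp
  have c2 := (hc.dx hΩ).hasDerivAt_dx hΩ hp
  have u1 := hs.hasDerivAt_dx hΩ hp
  have ut1 := hs.hasDerivAt_dt hΩ hp
  have u2 := hsx.hasDerivAt_dx hΩ hp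
  have u2t := hsx.hasDerivAt_dt hΩ hp
  have u3 := hsxx.hasDerivAt_dx hΩ hp
  have hLx : dx (dt u) t x + (dx u t x * dx u t x + u t x * dx (dx u) t x)
      + dx (dx (dx u)) t x = 0 := by
    have h0 := dx_congr hΩ (g := fun _ _ => 0) hL hp
    exact (((hst.hasDerivAt_dx hΩ hp).add (u1.mul u2)).add u3).deriv.symm.trans
      (h0.trans (by simp [dx]))
  have hLt : dt (dt u) t x + (dt u t x * dx u t x + u t x * dt (dx u) t x)
      + dt (dx (dx u)) t x = 0 := by
    have h0 := dt_congr hΩ (g := fun _ _ => 0) hL hp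
    exact (((hst.hasDerivAt_dt hΩ hp).add (ut1.mul u2t)).add
      (hsxx.hasDerivAt_dt hΩ hp)).deriv.symm.trans (h0.trans (by simp [dt]))
  have hχx : ∀ t x, (t, x) ∈ Ω → dx (dt u) t x = -(dx a t x / 2 * u t x ^ 2) + dx b t x * u t x
      + dx c t x + dx u t x * (3 / 4 * u t x ^ 2 - a t x * u t x + b t x)
      - dx u t x * (dx a t x - 1 / 2 * dx u t x)
      - (a t x - 1 / 2 * u t x) * dx (dx u) t x := by
    intro t x hp
    have a1 := ha.hasDerivAt_dx hΩ hp
    have b1 := hb.hasDerivAt_dx hΩ hp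
    have c1 := hc.hasDerivAt_dx hΩ hp
    have u1 := hs.hasDerivAt_dx hΩ hp
    have u2 := hsx.hasDerivAt_dx hΩ hp
    rw [dx_congr hΩ hχ hp]
    refine ((((((u1.pow 3).const_mul (1 / 4)).sub ((a1.div_const 2).mul (u1.pow 2))).add
      (b1.mul u1)).add c1).sub ((a1.sub (u1.const_mul (1 / 2))).mul u2)).deriv.trans ?_
    norm_num
    ring
  have hχt : dt (dt u) t x = -(dt a t x / 2 * u t x ^ 2) + dt b t x * u t x
      + dt c t x + dt u t x * (3 / 4 * u t x ^ 2 - a t x * u t x + b t x)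
      - dx u t x * (dt a t x - 1 / 2 * dt u t x)
      - (a t x - 1 / 2 * u t x) * dt (dx u) t x := by
    rw [dt_congr hΩ hχ hp]
    refine ((((((ut1.pow 3).const_mul (1 / 4)).sub ((at1.div_const 2).mul (ut1.pow 2))).add
      (bt1.mul ut1)).add ct1).sub ((at1.sub (ut1.const_mul (1 / 2))).mul u2t)).deriv.trans ?_
    norm_num
    ring
  have hχxx : dx (dx (dt u)) t x =
      -(dx (dx a) t x / 2 * u t x ^ 2) - dx a t x * u t x * dx u t x
      + dx (dx b) t x * u t x + dx b t x * dx u t x + dx (dx c) t x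
      + dx (dx u) t x * (3 / 4 * u t x ^ 2 - a t x * u t x + b t x)
      + dx u t x * (3 / 2 * u t x * dx u t x - dx a t x * u t x - a t x * dx u t x + dx b t x)
      - dx (dx u) t x * (dx a t x - 1 / 2 * dx u t x)
      - dx u t x * (dx (dx a) t x - 1 / 2 * dx (dx u) t x)
      - (dx a t x - 1 / 2 * dx u t x) * dx (dx u) t x
      - (a t x - 1 / 2 * u t x) * dx (dx (dx u)) t x := by
    rw [dx_congr hΩ hχx hp]
    refine ((((((((a2.div_const 2).mul (u1.pow 2)).neg).add (b2.mul u1)).add c2).add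
      (u2.mul ((((u1.pow 2).const_mul (3 / 4)).sub (a1.mul u1)).add b1))).sub
      (u2.mul (a2.sub (u2.const_mul (1 / 2))))).sub
      ((a1.sub (u1.const_mul (1 / 2))).mul u3)).deriv.trans ?_
    norm_num
    ring
  have hcomm : dt (dx u) t x = dx (dt u) t x := hs.dt_dx hΩ hp
  have hcomm2 : dt (dx (dx u)) t x = dx (dx (dt u)) t x :=
    (hsx.dt_dx hΩ hp).trans (dx_congr hΩ (fun _ _ h => hs.dt_dx hΩ h) hp)
  have hQ : (noGoField a b c).characteristic (jetOf u t x).toJet1 = 0 := by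
    have := hχ t x hp
    simp only [PlaneVectorField.characteristic, noGoField, jetOf]
    simp only [dt, dx] at this
    linear_combination -this
  refine (noGoField_prol2_burgersL hΩ ha hb hc (jetOf u t x) hp (hu.2 t x hp) hQ).symm.trans ?_
  rw [prol2_burgersL, noGoField_prolT hΩ ha hb hc _ hp, noGoField_prolX hΩ ha hb hc _ hp,
    noGoField_prolXX hΩ ha hb hc _ hp]
  have e1 : (jetOf u t x).u = u t x := rfl
  have e2 : (jetOf u t x).ux = dx u t x := rfl
  have e3 : (jetOf u t x).ut = dt u t x := rfl
  have e4 : (jetOf u t x).uxx = dx (dx u) t x := rfl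
  have e5 : (jetOf u t x).t = t := rfl
  have e6 : (jetOf u t x).x = x := rfl
  rw [e1, e2, e3, e4, e5, e6]
  simp only [noGoField]
  rw [hcomm] at hχt hLt
  rw [hcomm2] at hLt
  -- This is the characteristic form of the prolongation, Q_(2)L = (D_t + u D_x + u_x + D_x²)Q[u] +
  -- τ D_tL + ξ D_xL, in which every term vanishes on an invariant solution.
  linear_combination hLt - hχt - hχxx - u t x * hχx t x hp - dx u t x * hχ t x hp
    + (a t x - 1 / 2 * u t x) * hLx

theorem SmoothOn.const_mul_div {Ω : Set (ℝ × ℝ)} {f g : ℝ → ℝ → ℝ} (k : ℝ) (hf : SmoothOn Ω f)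
    (hg : SmoothOn Ω g) (h0 : ∀ t x, (t, x) ∈ Ω → g t x ≠ 0) :
    SmoothOn Ω (fun t x => k * (f t x / g t x)) :=
  contDiffOn_const.mul (ContDiffOn.div hf hg fun p hp => h0 p.1 p.2 hp)

theorem smoothOn_colDet {p q r : ℝ → ℝ → Fin 3 → ℝ} (hp : ∀ i, SmoothOn Ω (fun t x => p t x i))
    (hq : ∀ i, SmoothOn Ω (fun t x => q t x i)) (hr : ∀ i, SmoothOn Ω (fun t x => r t x i)) :
    SmoothOn Ω (fun t x => colDet (p t x) (q t x) (r t x)) := by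
  simp only [colDet_apply]
  have m : ∀ i j, SmoothOn Ω (fun t x => q t x i * r t x j) :=
    fun i j => ContDiffOn.mul (hq i) (hr j)
  exact ((ContDiffOn.mul (hp 0) (ContDiffOn.sub (m 1 2) (m 2 1))).add
    (ContDiffOn.mul (hp 1) (ContDiffOn.sub (m 2 0) (m 0 2)))).add
    (ContDiffOn.mul (hp 2) (ContDiffOn.sub (m 0 1) (m 1 0)))

/-- By Cramer's rule each uⁱ satisfies the relation expressing invariance under Q, which makes the
Δ's a solution of a homogeneous 3×3 linear system with determinant ±|e,u,y|/2, up to the order of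
its columns. Smoothness comes from the quotient formulas. -/
theorem isBurgersReductionOperator_of_representation (hΩ : IsOpen Ω)
    {v : Fin 3 → ℝ → ℝ → ℝ} (h : IsBurgersTripleRepresentation Ω v a b c) :
    IsBurgersReductionOperator Ω (noGoField a b c) := by
  obtain ⟨hv, hrep⟩ := h
  have hs : ∀ i, SmoothOn Ω (v i) := fun i => (hv i).1
  have se : ∀ i : Fin 3, SmoothOn Ω (fun _ _ => eCol i) := fun i => contDiffOn_const
  have su : ∀ i, SmoothOn Ω (fun t x => uCol v t x i) := hs
  have sy : ∀ i, SmoothOn Ω (fun t x => yCol v t x i) := fun i =>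
    (contDiffOn_const.mul ((hs i).dx hΩ)).add (ContDiffOn.pow (hs i) 2)
  have sz : ∀ i, SmoothOn Ω (fun t x => zCol v t x i) := fun i =>
    ((contDiffOn_const.mul (((hs i).dx hΩ).dx hΩ)).add
      ((contDiffOn_const.mul (hs i)).mul ((hs i).dx hΩ))).add (ContDiffOn.pow (hs i) 3)
  have sD := smoothOn_colDet se su sy
  have hD : ∀ t x, (t, x) ∈ Ω → colDet eCol (uCol v t x) (yCol v t x) ≠ 0 :=
    fun t x hp => (hrep t x hp).1
  have ha : SmoothOn Ω a := (SmoothOn.const_mul_div (1 / 2) (smoothOn_colDet se su sz) sD hD).congr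
    fun p hp => (hrep p.1 p.2 hp).2.1
  have hb : SmoothOn Ω b := (SmoothOn.const_mul_div (1 / 4) (smoothOn_colDet se sy sz) sD hD).congr
    fun p hp => (hrep p.1 p.2 hp).2.2.1
  have hc : SmoothOn Ω c :=
    (SmoothOn.const_mul_div (-(1 / 4)) (smoothOn_colDet su sy sz) sD hD).congr
    fun p hp => (hrep p.1 p.2 hp).2.2.2
  refine isBurgersReductionOperator_of_determiningEquations hΩ ha hb hc fun t x hp => ?_
  have hrel : ∀ i, -(1 / 2) * (dt a t x + dx (dx a) t x + 2 * a t x * dx a t x - 2 * dx b t x)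
        * yCol v t x i
      + (dt b t x + dx (dx b) t x + 2 * dx a t x * b t x + dx c t x) * uCol v t x i
      + (dt c t x + dx (dx c) t x + 2 * dx a t x * c t x) = 0 := by
    intro i
    have hy : yCol v t x i = 2 * dx (v i) t x + v i t x ^ 2 := rfl
    have hu : uCol v t x i = v i t x := rfl
    rw [hy, hu]
    linear_combination determining_relation_of_solution hΩ ha hb hc (hv i)
      (fun t x hp => (cramer_colDet (hrep t x hp).1).1 (hrep t x hp).2 i) hp
  obtain ⟨h1, h2, h3⟩ := eq_zero_of_colDet_ne_zero (hD t x hp) hrel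
  exact ⟨by linear_combination -2 * h1, h2, h3⟩

end InvariantSolutions

/-! ### Zero-curvature systems V_t = N V, V_x = M V -/

section LinearSystems

/-- Solutions of `dV = Γ V` are smooth where `Γ` is. -/
theorem contDiffOn_of_hasFDerivAt_flip {E F : Type*} [NormedAddCommGroup E] [NormedSpace ℝ E]
    [FiniteDimensional ℝ E] [NormedAddCommGroup F] [NormedSpace ℝ F]
    {Γ : E → E →L[ℝ] F →L[ℝ] F} {V : E → F} {U : Set E}
    (hU : IsOpen U) (hΓ : ContDiffOn ℝ ∞ Γ U)
    (hV : ∀ q ∈ U, HasFDerivAt V ((Γ q).flip (V q)) q) : ContDiffOn ℝ ∞ V U := by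
  refine contDiffOn_infty.2 fun n => ?_
  -- Bootstrapping: if V is Cⁿ, then dV = Γ V is Cⁿ, so V is Cⁿ⁺¹.
  induction n with
  | zero => exact contDiffOn_zero.2 fun q hq => (hV q hq).continuousAt.continuousWithinAt
  | succ n ih =>
    push_cast
    rw [contDiffOn_succ_iff_fderiv_of_isOpen hU]
    refine ⟨fun q hq => (hV q hq).differentiableAt.differentiableWithinAt, by simp, ?_⟩
    refine contDiffOn_clm_apply.2 fun k => ?_
    refine ContDiffOn.congr (f := fun q => Γ q k (V q)) ?_ fun q hq => by rw [(hV q hq).fderiv]; rfl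
    exact ((hΓ.of_le (by exact_mod_cast le_top)).clm_apply contDiffOn_const).clm_apply ih

/-- The maps A ↦ A dt and A ↦ A dx. As continuous linear maps they commute with differentiation,
which gives the derivative of N dt + M dx at once. -/
theorem exists_prod_form (G : Type*) [NormedAddCommGroup G] [NormedSpace ℝ G] :
    ∃ T X : G →L[ℝ] (ℝ × ℝ →L[ℝ] G), (∀ A k, T A k = k.1 • A) ∧ ∀ A k, X A k = k.2 • A :=
  ⟨ContinuousLinearMap.smulRightL ℝ (ℝ × ℝ) G (ContinuousLinearMap.fst ℝ ℝ ℝ),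
    ContinuousLinearMap.smulRightL ℝ (ℝ × ℝ) G (ContinuousLinearMap.snd ℝ ℝ ℝ),
    fun _ _ => rfl, fun _ _ => rfl⟩

/-- The one-form `N dt + M dx` with given smooth coefficients, together with its derivative. -/
theorem exists_oneForm {G : Type*} [NormedAddCommGroup G] [NormedSpace ℝ G] {Ω : Set (ℝ × ℝ)}
    (hΩ : IsOpen Ω) {N M : ℝ × ℝ → G} (hN : ContDiffOn ℝ ∞ N Ω) (hM : ContDiffOn ℝ ∞ M Ω) :
    ∃ Γ : ℝ × ℝ → ℝ × ℝ →L[ℝ] G, ContDiffOn ℝ ∞ Γ Ω ∧ (∀ q k, Γ q k = k.1 • N q + k.2 • M q) ∧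
      ∀ q ∈ Ω, ∀ h k, fderiv ℝ Γ q h k = k.1 • fderiv ℝ N q h + k.2 • fderiv ℝ M q h := by
  obtain ⟨T, X, hT, hX⟩ := exists_prod_form G
  refine ⟨fun q => T (N q) + X (M q),
    (T.contDiff.comp_contDiffOn hN).add (X.contDiff.comp_contDiffOn hM),
    fun q k => by simp [hT, hX], fun q hq h k => ?_⟩
  have dN : HasFDerivAt N (fderiv ℝ N q) q :=
    ((hN.contDiffAt (hΩ.mem_nhds hq)).differentiableAt (by simp)).hasFDerivAt
  have dM : HasFDerivAt M (fderiv ℝ M q) q :=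
    ((hM.contDiffAt (hΩ.mem_nhds hq)).differentiableAt (by simp)).hasFDerivAt
  have dΓ : fderiv ℝ (fun q => T (N q) + X (M q)) q
      = T.comp (fderiv ℝ N q) + X.comp (fderiv ℝ M q) :=
    ((T.hasFDerivAt.comp q dN).add (X.hasFDerivAt.comp q dM)).fderiv
  rw [dΓ]
  simp [hT, hX]

theorem map_prod_eq {G : Type*} [NormedAddCommGroup G] [NormedSpace ℝ G] (A : ℝ × ℝ →L[ℝ] G)
    (w : ℝ × ℝ) : A w = w.1 • A (1, 0) + w.2 • A (0, 1) := by
  conv_lhs => rw [show w = w.1 • ((1 : ℝ), (0 : ℝ)) + w.2 • ((0 : ℝ), (1 : ℝ)) by simp, map_add,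
    map_smul, map_smul]

/-- Local solvability of `V_t = N V`, `V_x = M V` under the zero curvature condition, for
operator-valued coefficients. -/
theorem exists_hasFDerivAt_of_zero_curvature {F : Type*} [NormedAddCommGroup F] [NormedSpace ℝ F]
    [CompleteSpace F] {Ω : Set (ℝ × ℝ)} (hΩ : IsOpen Ω) {N M : ℝ × ℝ → F →L[ℝ] F}
    (hN : ContDiffOn ℝ ∞ N Ω) (hM : ContDiffOn ℝ ∞ M Ω)
    (hcurv : ∀ q ∈ Ω, fderiv ℝ M q (1, 0) + (M q).comp (N q)
      = fderiv ℝ N q (0, 1) + (N q).comp (M q)) {p : ℝ × ℝ} (hp : p ∈ Ω) (v : F) :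
    ∃ (U : Set (ℝ × ℝ)) (V : ℝ × ℝ → F), IsOpen U ∧ p ∈ U ∧ U ⊆ Ω ∧ V p = v ∧
      ContDiffOn ℝ ∞ V U ∧ ∀ q ∈ U, ∃ V' : ℝ × ℝ →L[ℝ] F, HasFDerivAt V V' q ∧
        V' (1, 0) = N q (V q) ∧ V' (0, 1) = M q (V q) := by
  obtain ⟨Γ, sΓ, hΓ, hdΓ⟩ := exists_oneForm hΩ hN hM
  -- The difference of the two sides is alternating in (h, k), hence equals (h₁k₂ - h₂k₁)(M_t - N_x
  -- + MN - NM).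
  have hflat : ∀ q ∈ Ω, ∀ h k, fderiv ℝ Γ q h k + (Γ q k).comp (Γ q h)
      = fderiv ℝ Γ q k h + (Γ q h).comp (Γ q k) := by
    intro q hq h k
    have hB := eq_sub_of_add_eq (hcurv q hq)
    rw [hdΓ q hq, hdΓ q hq, hΓ, hΓ, map_prod_eq (fderiv ℝ N q) h, map_prod_eq (fderiv ℝ N q) k,
      map_prod_eq (fderiv ℝ M q) h, map_prod_eq (fderiv ℝ M q) k, hB]
    simp only [ContinuousLinearMap.add_comp, ContinuousLinearMap.comp_add,
      ContinuousLinearMap.smul_comp, ContinuousLinearMap.comp_smul]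
    module
  obtain ⟨V, hVp, hV⟩ := exists_hasFDerivAt_of_flat Γ p
    ((sΓ.contDiffAt (hΩ.mem_nhds hp)).of_le (WithTop.coe_le_coe.2 (le_top (a := (2 : ℕ∞)))))
    (Filter.eventually_of_mem (hΩ.mem_nhds hp) hflat) v
  obtain ⟨U, hUsub, hUo, hpU⟩ := mem_nhds_iff.1 (Filter.inter_mem hV (hΩ.mem_nhds hp))
  refine ⟨U, V, hUo, hpU, fun q hq => (hUsub hq).2, hVp, contDiffOn_of_hasFDerivAt_flip hUo
    (sΓ.mono fun q hq => (hUsub hq).2) fun q hq => (hUsub hq).1, fun q hq =>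
    ⟨_, (hUsub hq).1, ?_, ?_⟩⟩ <;> simp [hΓ]

/-- The continuous linear map attached to a square matrix. -/
noncomputable def matrixOp (n : ℕ) :
    (Fin n → Fin n → ℝ) →L[ℝ] ((Fin n → ℝ) →L[ℝ] (Fin n → ℝ)) :=
  LinearMap.toContinuousLinearMap
    { toFun := fun A => LinearMap.toContinuousLinearMap (Matrix.toLin' (Matrix.of A))
      map_add' := fun A B => by
        ext v i
        simp [Matrix.mulVec, dotProduct, add_mul, Finset.sum_add_distrib]
      map_smul' := fun k A => by
        ext v i
        simp [Matrix.mulVec, dotProduct, Finset.mul_sum, mul_assoc] }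

theorem matrixOp_apply {n : ℕ} (A : Fin n → Fin n → ℝ) (v : Fin n → ℝ) (i : Fin n) :
    matrixOp n A v i = ∑ j, A i j * v j := by
  simp [matrixOp, Matrix.mulVec, dotProduct]

/-- Local solvability of `V_t = N V`, `V_x = M V` under the zero curvature condition. -/
theorem exists_solution_of_zero_curvature {n : ℕ} {Ω : Set (ℝ × ℝ)} (hΩ : IsOpen Ω)
    (N M : ℝ → ℝ → Fin n → Fin n → ℝ)
    (hN : ∀ i j, SmoothOn Ω (fun t x => N t x i j)) (hM : ∀ i j, SmoothOn Ω (fun t x => M t x i j))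
    (hcurv : ∀ t x, (t, x) ∈ Ω → ∀ i j,
      dt (fun t x => M t x i j) t x + ∑ k, M t x i k * N t x k j
        = dx (fun t x => N t x i j) t x + ∑ k, N t x i k * M t x k j)
    {p : ℝ × ℝ} (hp : p ∈ Ω) (v : Fin n → ℝ) :
    ∃ (U : Set (ℝ × ℝ)) (V : Fin n → ℝ → ℝ → ℝ), IsOpen U ∧ p ∈ U ∧ U ⊆ Ω ∧
      (∀ i, V i p.1 p.2 = v i) ∧ (∀ i, SmoothOn U (V i)) ∧
      ∀ t x, (t, x) ∈ U → ∀ i, dt (V i) t x = ∑ j, N t x i j * V j t x ∧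
        dx (V i) t x = ∑ j, M t x i j * V j t x := by
  set NN : ℝ × ℝ → Fin n → Fin n → ℝ := fun q i j => N q.1 q.2 i j with hNN
  set MM : ℝ × ℝ → Fin n → Fin n → ℝ := fun q i j => M q.1 q.2 i j with hMM
  have sN : ContDiffOn ℝ ∞ NN Ω := contDiffOn_pi.2 fun i => contDiffOn_pi.2 fun j => hN i j
  have sM : ContDiffOn ℝ ∞ MM Ω := contDiffOn_pi.2 fun i => contDiffOn_pi.2 fun j => hM i j
  have hcomp : ∀ C D : Fin n → Fin n → ℝ, (matrixOp n C).comp (matrixOp n D)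
      = matrixOp n (fun i j => ∑ k, C i k * D k j) := by
    intro C D
    ext w i
    simp only [ContinuousLinearMap.comp_apply, matrixOp_apply, Finset.mul_sum, Finset.sum_mul]
    rw [Finset.sum_comm]
    simp only [mul_assoc]
  have hd : ∀ {K : ℝ × ℝ → Fin n → Fin n → ℝ}, ContDiffOn ℝ ∞ K Ω → ∀ q ∈ Ω,
      HasFDerivAt K (fderiv ℝ K q) q := fun hK q hq =>
    ((hK.contDiffAt (hΩ.mem_nhds hq)).differentiableAt (by simp)).hasFDerivAt
  have hdop : ∀ {K : ℝ × ℝ → Fin n → Fin n → ℝ}, ContDiffOn ℝ ∞ K Ω → ∀ q ∈ Ω, ∀ w,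
      fderiv ℝ (fun q => matrixOp n (K q)) q w = matrixOp n (fderiv ℝ K q w) := fun hK q hq w => by
    exact congrArg (fun T => T w) ((matrixOp n).hasFDerivAt.comp q (hd hK q hq)).fderiv
  obtain ⟨U, V, hUo, hpU, hUΩ, hVp, sV, hV⟩ := exists_hasFDerivAt_of_zero_curvature hΩ
    ((matrixOp n).contDiff.comp_contDiffOn sN) ((matrixOp n).contDiff.comp_contDiffOn sM)
    (fun q hq => by
      have e1 : ∀ i j, dt (fun t x => M t x i j) q.1 q.2 = fderiv ℝ MM q (1, 0) i j := fun i j =>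
        (hasDerivAt_slices_of_hasFDerivAt (t := q.1) (x := q.2) (f := fun t x => M t x i j)
          (hasFDerivAt_pi'.1 (hasFDerivAt_pi'.1 (hd sM q hq) i) j)).1.deriv
      have e2 : ∀ i j, dx (fun t x => N t x i j) q.1 q.2 = fderiv ℝ NN q (0, 1) i j := fun i j =>
        (hasDerivAt_slices_of_hasFDerivAt (t := q.1) (x := q.2) (f := fun t x => N t x i j)
          (hasFDerivAt_pi'.1 (hasFDerivAt_pi'.1 (hd sN q hq) i) j)).2.deriv
      simp only [Function.comp_def]
      rw [hdop sM q hq, hdop sN q hq, hcomp, hcomp, ← map_add, ← map_add]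
      congr 1
      ext i j
      have := hcurv q.1 q.2 hq i j
      rw [e1, e2] at this
      exact this) hp v
  refine ⟨U, fun i t x => V (t, x) i, hUo, hpU, hUΩ, fun i => ?_,
    fun i => contDiffOn_pi.1 sV i, fun t x hq i => ?_⟩
  · rw [← hVp]
  · obtain ⟨V', hV', h10, h01⟩ := hV _ hq
    have h1 := hasDerivAt_slices_of_hasFDerivAt (f := fun t x => V (t, x) i)
      (hasFDerivAt_pi'.1 hV' i)
    constructor
    · refine h1.1.deriv.trans ((congrFun h10 i).trans (matrixOp_apply _ _ _))
    · refine h1.2.deriv.trans ((congrFun h01 i).trans (matrixOp_apply _ _ _))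

end LinearSystems

/-! ### Hopf–Cole linearization and construction of the three solutions -/

section HopfCole

variable {Ω : Set (ℝ × ℝ)} {a b c : ℝ → ℝ → ℝ}

/-- Local solutions of `v_t = -v_xx`, `v_xxx = a v_xx - b v_x - (c/2) v`, as a first-order system
for `(v, v_x, v_xx)`. -/
theorem exists_linear_solution (hΩ : IsOpen Ω) (ha : SmoothOn Ω a) (hb : SmoothOn Ω b)
    (hc : SmoothOn Ω c) (h : DeterminingEquations Ω a b c) {p : ℝ × ℝ} (hp : p ∈ Ω)
    (v : Fin 3 → ℝ) :
    ∃ (U : Set (ℝ × ℝ)) (V : Fin 3 → ℝ → ℝ → ℝ), IsOpen U ∧ p ∈ U ∧ U ⊆ Ω ∧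
      (∀ i, V i p.1 p.2 = v i) ∧ (∀ i, SmoothOn U (V i)) ∧
      ∀ t x, (t, x) ∈ U → dt (V 0) t x = -V 2 t x ∧
        dt (V 1) t x = -(a t x * V 2 t x - b t x * V 1 t x - c t x / 2 * V 0 t x) ∧
        dx (V 0) t x = V 1 t x ∧ dx (V 1) t x = V 2 t x ∧
        dx (V 2) t x = a t x * V 2 t x - b t x * V 1 t x - c t x / 2 * V 0 t x := by
  have k : ∀ r : ℝ, SmoothOn Ω (fun _ _ => r) := fun r => contDiffOn_const
  have hax := ha.dx hΩ
  have hbx := hb.dx hΩ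
  have hcx := hc.dx hΩ
  have hc2 : SmoothOn Ω (fun t x => c t x / 2) := ContDiffOn.div_const hc 2
  have e0 : SmoothOn Ω (fun t x => dx c t x / 2 + a t x * (c t x / 2)) :=
    (ContDiffOn.div_const hcx 2).add (ContDiffOn.mul ha hc2)
  have e1 : SmoothOn Ω (fun t x => dx b t x + a t x * b t x + c t x / 2) :=
    (ContDiffOn.add hbx (ContDiffOn.mul ha hb)).add hc2
  have e2 : SmoothOn Ω (fun t x => b t x - a t x ^ 2 - dx a t x) :=
    (ContDiffOn.sub hb (ContDiffOn.pow ha 2)).sub hax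
  obtain ⟨U, V, hU, hpU, hUΩ, hVp, hVs, hV⟩ := exists_solution_of_zero_curvature hΩ
    -- The rows express v_t = -v_xx and its first two x-derivatives, with v_xxx eliminated by the
    -- third-order equation.
    (fun t x => ![![0, 0, -1], ![c t x / 2, b t x, -a t x],
      ![dx c t x / 2 + a t x * (c t x / 2), dx b t x + a t x * b t x + c t x / 2,
        b t x - a t x ^ 2 - dx a t x]])
    (fun t x => ![![0, 1, 0], ![0, 0, 1], ![-(c t x / 2), -b t x, a t x]])
    (by
      intro i j
      fin_cases i <;> fin_cases j <;> simp
      exacts [k 0, k 0, k (-1), hc2, hb, ContDiffOn.neg ha, e0, e1, e2])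
    (by
      intro i j
      fin_cases i <;> fin_cases j <;> simp
      exacts [k 0, k 1, k 0, k 0, k 0, k 1, ContDiffOn.neg hc2, ContDiffOn.neg hb, ha])
    (by
      intro t x hq
      obtain ⟨d1, d2, d3⟩ := h t x hq
      have zt : ∀ r : ℝ, dt (fun _ _ => r) t x = 0 := fun r => by simp [dt]
      have zx : ∀ r : ℝ, dx (fun _ _ => r) t x = 0 := fun r => by simp [dx]
      have a1 := ha.hasDerivAt_dx hΩ hq
      have b1 := hb.hasDerivAt_dx hΩ hq
      have c1 := hc.hasDerivAt_dx hΩ hq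
      have t1 : dt (fun t x => -(c t x / 2)) t x = -(dt c t x / 2) :=
        ((hc.hasDerivAt_dt hΩ hq).div_const 2).neg.deriv
      have t2 : dt (fun t x => -b t x) t x = -dt b t x := (hb.hasDerivAt_dt hΩ hq).neg.deriv
      have x1 : dx (fun t x => c t x / 2) t x = dx c t x / 2 := (c1.div_const 2).deriv
      have x2 : dx (fun t x => -a t x) t x = -dx a t x := a1.neg.deriv
      have x3 : dx (fun t x => dx c t x / 2 + a t x * (c t x / 2)) t x = dx (dx c) t x / 2
          + (dx a t x * (c t x / 2) + a t x * (dx c t x / 2)) :=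
        (((hcx.hasDerivAt_dx hΩ hq).div_const 2).add (a1.mul (c1.div_const 2))).deriv
      have x4 : dx (fun t x => dx b t x + a t x * b t x + c t x / 2) t x = dx (dx b) t x
          + (dx a t x * b t x + a t x * dx b t x) + dx c t x / 2 :=
        (((hbx.hasDerivAt_dx hΩ hq).add (a1.mul b1)).add (c1.div_const 2)).deriv
      have x5 : dx (fun t x => b t x - a t x ^ 2 - dx a t x) t x = dx b t x
          - 2 * a t x * dx a t x - dx (dx a) t x :=
        ((b1.sub (a1.pow 2)).sub (hax.hasDerivAt_dx hΩ hq)).deriv.trans (by norm_num)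
      intro i j
      fin_cases i <;> fin_cases j <;>
        simp [Fin.sum_univ_three, zt, zx, t1, t2, x1, x2, x3, x4, x5]
      · linear_combination
      · ring
      -- The first two rows of the curvature vanish identically; the last row reproduces the three
      -- determining equations.
      · linear_combination -(1 / 2) * d3
      · linear_combination -d2
      · linear_combination d1)
    hp v
  refine ⟨U, V, hU, hpU, hUΩ, hVp, hVs, fun t x hq => ?_⟩
  have h0 := hV t x hq 0
  have h1 := hV t x hq 1
  have h2 := hV t x hq 2
  simp [Fin.sum_univ_three] at h0 h1 h2
  refine ⟨h0.1, ?_, h0.2, h1.2, ?_⟩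
  · rw [h1.1]; ring
  · rw [h2.2]; ring

/-- Local solutions of the Burgers equation invariant under `Q`, with prescribed 1-jet in `x`. -/
theorem exists_invariant_solution (hΩ : IsOpen Ω) (ha : SmoothOn Ω a) (hb : SmoothOn Ω b)
    (hc : SmoothOn Ω c) (h : DeterminingEquations Ω a b c) {p : ℝ × ℝ} (hp : p ∈ Ω)
    (u₀ y₀ : ℝ) :
    ∃ (U : Set (ℝ × ℝ)) (u : ℝ → ℝ → ℝ), IsOpen U ∧ p ∈ U ∧ U ⊆ Ω ∧ IsBurgersSolution U u ∧
      u p.1 p.2 = u₀ ∧ 2 * dx u p.1 p.2 + u p.1 p.2 ^ 2 = y₀ ∧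
      ∀ t x, (t, x) ∈ U → 4 * dx (dx u) t x + 6 * u t x * dx u t x + u t x ^ 3
        = 2 * a t x * (2 * dx u t x + u t x ^ 2) - 4 * b t x * u t x - 4 * c t x := by
  -- Since u = 2v_x/v and y = 4v_xx/v, the data v = 1, v_x = u₀/2, v_xx = y₀/4 prescribe u = u₀ and
  -- y = y₀ at p.
  obtain ⟨W, V, hWo, hpW, hWΩ, hVp, hVs, hV⟩ :=
    exists_linear_solution hΩ ha hb hc h hp ![1, u₀ / 2, y₀ / 4]
  have hV0 : V 0 p.1 p.2 = 1 := hVp 0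
  have hV1 : V 1 p.1 p.2 = u₀ / 2 := hVp 1
  have hV2 : V 2 p.1 p.2 = y₀ / 4 := hVp 2
  have hne : ∀ᶠ q : ℝ × ℝ in 𝓝 p, V 0 q.1 q.2 ≠ 0 :=
    ((hVs 0).contDiffAt hWo hpW).continuousAt.eventually_ne (by simp [hV0])
  obtain ⟨U, hUsub, hUo, hpU⟩ := mem_nhds_iff.1 (Filter.inter_mem hne (hWo.mem_nhds hpW))
  have hUW : U ⊆ W := fun q hq => (hUsub hq).2
  have hs : ∀ i, SmoothOn U (V i) := fun i => ContDiffOn.mono (hVs i) hUW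
  have hn : ∀ t x, (t, x) ∈ U → V 0 t x ≠ 0 := fun t x hq => (hUsub hq).1
  set u : ℝ → ℝ → ℝ := fun t x => 2 * (V 1 t x / V 0 t x) with hu
  have us : SmoothOn U u := SmoothOn.const_mul_div 2 (hs 1) (hs 0) hn
  have hux : ∀ t x, (t, x) ∈ U →
      dx u t x = 2 * ((V 2 t x * V 0 t x - V 1 t x * V 1 t x) / V 0 t x ^ 2) := by
    intro t x hq
    obtain ⟨-, -, e3, e4, -⟩ := hV t x (hUW hq)
    have := ((((hs 1).hasDerivAt_dx hUo hq).div ((hs 0).hasDerivAt_dx hUo hq)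
      (hn t x hq)).const_mul 2).deriv
    rw [e3, e4] at this
    exact this
  have hut : ∀ t x, (t, x) ∈ U → dt u t x =
      2 * ((-(a t x * V 2 t x - b t x * V 1 t x - c t x / 2 * V 0 t x) * V 0 t x
        - V 1 t x * -V 2 t x) / V 0 t x ^ 2) := by
    intro t x hq
    obtain ⟨e1, e2, -, -, -⟩ := hV t x (hUW hq)
    have := ((((hs 1).hasDerivAt_dt hUo hq).div ((hs 0).hasDerivAt_dt hUo hq)
      (hn t x hq)).const_mul 2).deriv
    rw [e1, e2] at this
    exact this
  have huxx : ∀ t x, (t, x) ∈ U → dx (dx u) t x =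
      2 * ((((a t x * V 2 t x - b t x * V 1 t x - c t x / 2 * V 0 t x) * V 0 t x
          + V 2 t x * V 1 t x - (V 2 t x * V 1 t x + V 1 t x * V 2 t x)) * V 0 t x ^ 2
        - (V 2 t x * V 0 t x - V 1 t x * V 1 t x) * (2 * V 0 t x * V 1 t x))
          / (V 0 t x ^ 2) ^ 2) := by
    intro t x hq
    obtain ⟨-, -, e3, e4, e5⟩ := hV t x (hUW hq)
    have d0 := (hs 0).hasDerivAt_dx hUo hq
    have d1 := (hs 1).hasDerivAt_dx hUo hq
    have d2 := (hs 2).hasDerivAt_dx hUo hq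
    rw [e3] at d0
    rw [e4] at d1
    rw [e5] at d2
    rw [dx_congr hUo hux hq]
    refine (((((d2.mul d0).sub (d1.mul d1)).div (d0.pow 2)
      (pow_ne_zero 2 (hn t x hq))).const_mul 2)).deriv.trans ?_
    norm_num
  refine ⟨U, u, hUo, hpU, hUW.trans hWΩ, ⟨us, fun t x hq => ?_⟩, ?_, ?_, fun t x hq => ?_⟩
  · have : dt u t x + u t x * dx u t x + dx (dx u) t x = 0 := by
      rw [hut t x hq, huxx t x hq, hux t x hq, hu]
      have := hn t x hq
      field_simp
      ring
    exact this
  · simp only [hu, hV0, hV1]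
    ring
  · rw [hux p.1 p.2 hpU]
    simp only [hu, hV0, hV1, hV2]
    ring
  · rw [huxx t x hq, hux t x hq, hu]
    have := hn t x hq
    field_simp
    ring

/-- Invariant solutions can be given any values (u, y) at p. The values (0,0), (1,0), (0,1) make
|e,u,y| = 1 there, and by continuity it stays nonzero nearby, where Cramer's rule applies. -/
theorem exists_representation_of_determiningEquations (hΩ : IsOpen Ω) (ha : SmoothOn Ω a)
    (hb : SmoothOn Ω b) (hc : SmoothOn Ω c) (h : DeterminingEquations Ω a b c) {p : ℝ × ℝ}
    (hp : p ∈ Ω) :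
    ∃ U : Set (ℝ × ℝ), IsOpen U ∧ p ∈ U ∧ U ⊆ Ω ∧
      ∃ u : Fin 3 → ℝ → ℝ → ℝ, IsBurgersTripleRepresentation U u a b c := by
  choose W u hWo hpW hWΩ hsol hu hy hz using fun i : Fin 3 =>
    exists_invariant_solution hΩ ha hb hc h hp ((![0, 1, 0] : Fin 3 → ℝ) i)
      ((![0, 0, 1] : Fin 3 → ℝ) i)
  have hW : IsOpen (⋂ i, W i) := isOpen_iInter_of_finite hWo
  have hpW' : p ∈ ⋂ i, W i := Set.mem_iInter.2 hpW
  have hsub : ∀ i, (⋂ i, W i) ⊆ W i := fun i => Set.iInter_subset W i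
  have hs : ∀ i, SmoothOn (⋂ i, W i) (u i) := fun i => ContDiffOn.mono (hsol i).1 (hsub i)
  have sy : ∀ i, SmoothOn (⋂ i, W i) (fun t x => yCol u t x i) := fun i =>
    (contDiffOn_const.mul ((hs i).dx hW)).add (ContDiffOn.pow (hs i) 2)
  have sD : SmoothOn (⋂ i, W i) (fun t x => colDet eCol (uCol u t x) (yCol u t x)) :=
    smoothOn_colDet (fun i => contDiffOn_const) hs sy
  have hD : colDet eCol (uCol u p.1 p.2) (yCol u p.1 p.2) ≠ 0 := by
    have e1 : uCol u p.1 p.2 = ![0, 1, 0] := funext hu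
    have e2 : yCol u p.1 p.2 = ![0, 0, 1] := funext hy
    rw [e1, e2, colDet_eCol]
    simp
  have hne : ∀ᶠ q : ℝ × ℝ in 𝓝 p, colDet eCol (uCol u q.1 q.2) (yCol u q.1 q.2) ≠ 0 :=
    (sD.contDiffAt hW hpW').continuousAt.eventually_ne hD
  obtain ⟨U, hUsub, hUo, hpU⟩ := mem_nhds_iff.1 (Filter.inter_mem hne (hW.mem_nhds hpW'))
  have hUW : ∀ i, U ⊆ W i := fun i q hq => hsub i (hUsub hq).2
  refine ⟨U, hUo, hpU, (hUW 0).trans (hWΩ 0), u,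
    fun i => ⟨(hsol i).1.mono (hUW i), fun t x hq => (hsol i).2 t x (hUW i hq)⟩,
    fun t x hq => ?_⟩
  have hDq : colDet eCol (uCol u t x) (yCol u t x) ≠ 0 := (hUsub hq).1
  exact ⟨hDq, (cramer_colDet hDq).2 fun i => hz i t x (hUW i hq)⟩

end HopfCole

theorem mainTheorem2 (Ω : Set (ℝ × ℝ)) (hΩ : IsOpen Ω) (ξ0 η1 η0 : ℝ → ℝ → ℝ) :
    (IsBurgersReductionOperator Ω (noGoField ξ0 η1 η0) →
      ∀ p ∈ Ω, ∃ U : Set (ℝ × ℝ), IsOpen U ∧ p ∈ U ∧ U ⊆ Ω ∧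
        ∃ u : Fin 3 → ℝ → ℝ → ℝ, IsBurgersTripleRepresentation U u ξ0 η1 η0) ∧
    ((∃ u : Fin 3 → ℝ → ℝ → ℝ, IsBurgersTripleRepresentation Ω u ξ0 η1 η0) →
      IsBurgersReductionOperator Ω (noGoField ξ0 η1 η0)) := by
  refine ⟨fun h p hp => ?_, fun ⟨_, hu⟩ => isBurgersReductionOperator_of_representation hΩ hu⟩
  obtain ⟨ha, hb, hc⟩ := smoothOn_of_isBurgersReductionOperator h
  exact exists_representation_of_determiningEquations hΩ ha hb hc
    (determiningEquations_of_isBurgersReductionOperator hΩ h) hp
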